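/- Let $n\ge 1$ be an integer, let $q,a,b,z,x_1,\dots,x_n\in\mathbb C$ with $0<|q|<1$, and write $(u)_m=\prod_{i=0}^{m-1}(1-uq^i)$ for $m\ge 0$, $(u,v)_m=(u)_m(v)_m$, and $|\boldsymbol k|=k_1+\cdots+k_n$ for $\boldsymbol k=(k_1,\dots,k_n)\in\mathbb Z_{\ge0}^n$. Assume $|z/a^{n-1}|<1$. The following are two $A_n$ extensions of the Rogers--Fine identity; in each of them all series converge absolutely. (1) If none of the denominators in the identity vanishes (that is, $a^{n-1}\neq0$, $b\ne 0$, all $x_r\neq 0$, $x_r\ne x_s$ for $r<s$, and $(qx_r/x_s)_m\neq0$, $(b)_m\ne0$ for all $r,s$ and all $m\geq0$), then \begin{align*} &\sum_{\boldsymbol j\in\mathbb Z_{\ge0}^n}\ \prod_{1\le r<s\le n}\frac{1-q^{j_r-j_s}x_r/x_s}{1-x_r/x_s}\prod_{r,s=1}^n\frac{(ax_r/x_s)_{j_r}}{(qx_r/x_s)_{j_r}}\,\frac{(q)_{|\boldsymbol j|}}{(b)_{|\boldsymbol j|}}\Big(\frac{z}{a^{n-1}}\Big)^{|\boldsymbol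 j|}q^{\sum_{r=1}^n(r-1)j_r}\\ &=\sum_{\boldsymbol k\in\mathbb Z_{\ge0}^n}\ \prod_{1\le r<s\le n}\frac{1-q^{k_r-k_s}x_r/x_s}{1-x_r/x_s}\prod_{r,s=1}^n\frac{(ax_r/x_s)_{k_r}}{(qx_r/x_s)_{k_r}}\,\frac{(1-azq^{2|\boldsymbol k|})(q,azq/b)_{|\boldsymbol k|}}{(b)_{|\boldsymbol k|}(z/a^{n-1})_{|\boldsymbol k|+1}}\Big(\frac{bz}{a^{n-1}}\Big)^{|\boldsymbol k|}q^{\sum_{r=1}^n(r-1)k_r+2\binom{|\boldsymbol k|}{2}}. \end{align*} (2) If none of the denominators in the identity vanishes (that is, the same conditions with $(b)_m\ne0$ replaced by $(bx_i)_m\neq0$ for all $i$ and all $m\ge0$), then \begin{align*} &\sum_{\boldsymbol j\in\mathbb Z_{\ge0}^n}\ \prod_{1\le r<s\le n}\frac{1-q^{j_r-j_s}x_r/x_s}{1-x_r/x_s}\prod_{r,s=1}^n\frac{(ax_r/x_s)_{j_r}}{(qx_r/x_s)_{j_r}}\,\frac{(q)_{|\boldsymbol j|}}{\prod_{i=1}^n(bx_i)_{j_i}}\Big(\frac{z}{a^{n-1}}\Big)^{|\boldsymbol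 j|}q^{\sum_{r=1}^n(r-1)j_r}\\ &=\sum_{\boldsymbol k\in\mathbb Z_{\ge0}^n}\ \prod_{1\le r<s\le n}\frac{1-q^{k_r-k_s}x_r/x_s}{1-x_r/x_s}\prod_{r,s=1}^n\frac{(ax_r/x_s)_{k_r}}{(qx_r/x_s)_{k_r}}\,\frac{(1-azq^{2|\boldsymbol k|})(q)_{|\boldsymbol k|}}{(z/a^{n-1})_{|\boldsymbol k|+1}}\prod_{i=1}^n\frac{(azq^{1+|\boldsymbol k|-k_i}/bx_i)_{k_i}}{(bx_i)_{k_i}}\\ &\qquad\times\Big(\frac{bz}{a^{n-1}}\Big)^{|\boldsymbol k|}q^{\sum_{r=1}^n(r-1)k_r+\binom{|\boldsymbol k|}{2}+\sum_{i=1}^n\binom{k_i}{2}}\prod_{i=1}^nx_i^{k_i}. \end{align*} Here $azq^{1+|\boldsymbol k|-k_i}/bx_i$ means $azq^{1+|\boldsymbol k|-k_i}/(bx_i)$. -/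

import Mathlib

open scoped BigOperators

noncomputable section

/-- The finite `q`-shifted factorial `(z; q)_m = ∏_{i < m} (1 - z q ^ i)`. -/
def qShifted (q z : ℂ) (m : ℕ) : ℂ :=
  ∏ i ∈ Finset.range m, (1 - z * q ^ i)

/-- The length `|k| = k_1 + ⋯ + k_n` of a multi-index. -/
def multiLen {n : ℕ} (k : Fin n → ℕ) : ℕ := ∑ r, k r

/-- `∏_{r < s} (1 - q ^ (k_r - k_s) x_r / x_s) / (1 - x_r / x_s)`, with integer exponents. -/
def AnFactor {n : ℕ} (q : ℂ) (x : Fin n → ℂ) (k : Fin n → ℕ) : ℂ :=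
  ∏ r, ∏ s ∈ Finset.Ioi r,
    (1 - q ^ ((k r : ℤ) - (k s : ℤ)) * (x r / x s)) / (1 - x r / x s)

/-- `∏_{r, s} (a x_r / x_s)_{k_r} / (q x_r / x_s)_{k_r}`. -/
def AnRatio {n : ℕ} (q a : ℂ) (x : Fin n → ℂ) (k : Fin n → ℕ) : ℂ :=
  ∏ r, ∏ s, qShifted q (a * (x r / x s)) (k r) / qShifted q (q * (x r / x s)) (k r)

/-- The exponent `∑_r (r - 1) k_r`; the index `r : Fin n` counts from `0`. -/
def AnWeight {n : ℕ} (k : Fin n → ℕ) : ℕ := ∑ r : Fin n, (r : ℕ) * k r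

/-- Left-hand term of the first identity. -/
def firstLhsTerm {n : ℕ} (q a b z : ℂ) (x : Fin n → ℂ) (j : Fin n → ℕ) : ℂ :=
  AnFactor q x j * AnRatio q a x j
    * (qShifted q q (multiLen j) / qShifted q b (multiLen j))
    * (z / a ^ (n - 1)) ^ multiLen j * q ^ AnWeight j

/-- Right-hand term of the first identity. -/
def firstRhsTerm {n : ℕ} (q a b z : ℂ) (x : Fin n → ℂ) (k : Fin n → ℕ) : ℂ :=
  AnFactor q x k * AnRatio q a x k
    * ((1 - a * z * q ^ (2 * multiLen k))
        * (qShifted q q (multiLen k) * qShifted q (a * z * q / b) (multiLen k))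
        / (qShifted q b (multiLen k) * qShifted q (z / a ^ (n - 1)) (multiLen k + 1)))
    * (b * z / a ^ (n - 1)) ^ multiLen k
    * q ^ (AnWeight k + 2 * (multiLen k).choose 2)

/-- Left-hand term of the second identity. -/
def secondLhsTerm {n : ℕ} (q a b z : ℂ) (x : Fin n → ℂ) (j : Fin n → ℕ) : ℂ :=
  AnFactor q x j * AnRatio q a x j
    * (qShifted q q (multiLen j) / ∏ i, qShifted q (b * x i) (j i))
    * (z / a ^ (n - 1)) ^ multiLen j * q ^ AnWeight j

/-- Right-hand term of the second identity. The natural-number exponent `1 + |k| - k_i` is never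
truncated, since `k_i ≤ |k|`. -/
def secondRhsTerm {n : ℕ} (q a b z : ℂ) (x : Fin n → ℂ) (k : Fin n → ℕ) : ℂ :=
  AnFactor q x k * AnRatio q a x k
    * ((1 - a * z * q ^ (2 * multiLen k)) * qShifted q q (multiLen k)
        / qShifted q (z / a ^ (n - 1)) (multiLen k + 1))
    * (∏ i, qShifted q (a * z * q ^ (1 + multiLen k - k i) / (b * x i)) (k i)
        / qShifted q (b * x i) (k i))
    * (b * z / a ^ (n - 1)) ^ multiLen k
    * q ^ (AnWeight k + (multiLen k).choose 2 + ∑ i, (k i).choose 2)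
    * ∏ i, x i ^ k i

end

open scoped BigOperators
open Finset Filter Topology

/-! With `Z = z / a^(n-1)`, both sides are brought to a normal form. The product `vanTerm` is the
`A_n` part. The `b`-dependent factors on the right become `chuPoly` evaluated at `y = a^n Z q^|k|`.

A multidimensional terminating `q`-Chu–Vandermonde expansion (`sum_chuSum`) writes `chuPoly` as a
sum over multi-indices `j`, supported on `j ≤ k`. For fixed `j`, the sum over all `k` with `|k| = K`
has a closed form (`sum_levelTerm`). What remains is a single series in `K - |j|`, whose terms are
`rogersTerm` and whose sum is `(q)_|j|` (`tendsto_sum_rogersTerm`). This is exactly the coefficient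
on the left. The interchange of sums is carried out on the partial sums `|k| < M`, followed by
dominated convergence (`tsum_vanTerm_eq`). This gives the second identity.

Both multidimensional summations rest on one partial fraction formula, `sum_prod_div_mul_prod`. It
expresses a scalar factor attached to a level as a sum over the `n` directions. Shifting each
direction back by one lattice step then relates level `K + 1` to level `K`.

In the first identity everything except `vanTerm` depends on `|k|` alone. The level sums of
`vanTerm` depend only on `a^n` and `|k|` (`sum_vanTerm`), so this identity is the case `n = 1` of
the normal form with `a^n` in place of `a`. -/

theorem qShifted_zero (q z : ℂ) : qShifted q z 0 = 1 := by simp [qShifted]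

theorem qShifted_succ (q z : ℂ) (m : ℕ) :
    qShifted q z (m + 1) = qShifted q z m * (1 - z * q ^ m) := by
  simp [qShifted, prod_range_succ]

theorem qShifted_succ_left (q z : ℂ) (m : ℕ) :
    qShifted q z (m + 1) = (1 - z) * qShifted q (z * q) m := by
  simp only [qShifted, prod_range_succ', pow_zero, mul_one]
  rw [mul_comm]
  congr 1
  exact prod_congr rfl fun i _ => by ring

theorem qShifted_shift (q z : ℂ) (m : ℕ) :
    qShifted q z m * (1 - z * q ^ m) = (1 - z) * qShifted q (z * q) m := by
  rw [← qShifted_succ, qShifted_succ_left]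

/-! ### Partial fractions and reindexing between lattice levels. -/

/-- A partial fraction expansion in polynomial form. -/
theorem sum_prod_div_mul_prod {ι : Type*} [Fintype ι] [DecidableEq ι] (u t : ι → ℂ)
    (hu : ∀ i, u i ≠ 0) (hinj : Function.Injective u) (ζ : ℂ) :
    ∑ i, (∏ s, (1 - t s * u i / u s)) / (∏ s ∈ univ.erase i, (1 - u i / u s))
        * ∏ s ∈ univ.erase i, (1 - u s * ζ)
      = ∏ s, (1 - u s * ζ) - ∏ s, (t s - u s * ζ) := by
  classical
  -- Two monic polynomials of equal degree: the leading terms cancel, so `p` is determined by its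
  -- values at the nodes `(u s)⁻¹`, where the first product vanishes.
  let p : Polynomial ℂ := ∏ s, (Polynomial.X - Polynomial.C (u s)⁻¹)
    - ∏ s, (Polynomial.X - Polynomial.C (t s * (u s)⁻¹))
  have hp : p.degree < (univ : Finset ι).card := by
    have h1 := Polynomial.monic_prod_X_sub_C (fun s => (u s)⁻¹) (univ : Finset ι)
    have h2 := Polynomial.monic_prod_X_sub_C (fun s => t s * (u s)⁻¹) (univ : Finset ι)
    have d1 : (∏ s, (Polynomial.X - Polynomial.C (u s)⁻¹)).degree
        = ((univ : Finset ι).card : WithBot ℕ) := by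
      rw [Polynomial.degree_prod]; simp
    have d2 : (∏ s, (Polynomial.X - Polynomial.C (t s * (u s)⁻¹))).degree
        = ((univ : Finset ι).card : WithBot ℕ) := by
      rw [Polynomial.degree_prod]; simp only [Polynomial.degree_X_sub_C]; simp
    rw [← d1]
    exact Polynomial.degree_sub_lt_left (d1.trans d2.symm) h1.ne_zero
      (h1.leadingCoeff.trans h2.leadingCoeff.symm)
  have hinj' : Set.InjOn (fun s => (u s)⁻¹) (univ : Finset ι) :=
    fun a _ b _ h => hinj (inv_injective h)
  have hL := congrArg (Polynomial.eval ζ) (Lagrange.eq_interpolate hinj' hp)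
  have hp_eval : ∀ y, p.eval y * ∏ s, (-u s)
      = ∏ s, (1 - u s * y) - ∏ s, (t s - u s * y) := by
    intro y
    simp only [p, Polynomial.eval_sub, Polynomial.eval_prod, Polynomial.eval_X, Polynomial.eval_C,
      sub_mul, ← prod_mul_distrib]
    congr 1 <;> refine prod_congr rfl fun s _ => ?_ <;> have := hu s <;> field_simp <;> ring
  rw [← hp_eval, hL, Lagrange.interpolate_apply, Polynomial.eval_finsetSum, sum_mul]
  refine sum_congr rfl fun i _ => ?_
  rw [Polynomial.eval_mul, Polynomial.eval_C, mul_right_comm, hp_eval]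
  have h0 : ∏ s, (1 - u s * (u i)⁻¹) = 0 :=
    prod_eq_zero (mem_univ i) (by rw [mul_inv_cancel₀ (hu i), sub_self])
  rw [h0, zero_sub, Lagrange.basis, Polynomial.eval_prod]
  simp only [Lagrange.basisDivisor, Polynomial.eval_mul, Polynomial.eval_C, Polynomial.eval_sub,
    Polynomial.eval_X]
  have h1 : ∏ s, (t s - u s * (u i)⁻¹)
      = (∏ s, (1 - t s * u i / u s)) * (-∏ s ∈ univ.erase i, (-(u s / u i))) := by
    -- The outer sign is the missing factor `-(u i / u i)`.
    have : -∏ s ∈ univ.erase i, (-(u s / u i)) = ∏ s, (-(u s / u i)) := by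
      rw [← mul_prod_erase univ _ (mem_univ i), div_self (hu i)]; ring
    rw [this, ← prod_mul_distrib]
    refine prod_congr rfl fun s _ => ?_
    have := hu s; have := hu i
    field_simp; ring
  rw [h1]
  have h2 : (∏ s ∈ univ.erase i, ((u i)⁻¹ - (u s)⁻¹)⁻¹ * (ζ - (u s)⁻¹))
      * ∏ s ∈ univ.erase i, (-(u s / u i)) = 
      (∏ s ∈ univ.erase i, (1 - u s * ζ)) / ∏ s ∈ univ.erase i, (1 - u i / u s) := by
    rw [← prod_mul_distrib, ← prod_div_distrib]
    refine prod_congr rfl fun s hs => ?_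
    have hne : u s - u i ≠ 0 := sub_ne_zero.2 fun h => (mem_erase.1 hs).1 (hinj h)
    have := hu s; have := hu i
    have e : (u i)⁻¹ - (u s)⁻¹ = (u s - u i) / (u i * u s) := by field_simp
    have e' : 1 - u i / u s = (u s - u i) / u s := by field_simp
    rw [e, e']
    field_simp; ring
  rw [div_mul_eq_mul_div, mul_div_assoc, ← h2]
  ring

/-- Taking `t s` to be a power of `q` times a constant, the right side becomes a factor depending
only on the level. This is how the level factors in the recurrences arise. -/
theorem sum_prod_div {ι : Type*} [Fintype ι] [DecidableEq ι] (u t : ι → ℂ)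
    (hu : ∀ i, u i ≠ 0) (hinj : Function.Injective u) :
    ∑ i, (∏ s, (1 - t s * u i / u s)) / (∏ s ∈ univ.erase i, (1 - u i / u s))
      = 1 - ∏ s, t s := by
  simpa using sum_prod_div_mul_prod u t hu hinj 0

/-- Reindexing of a sum over lattice points of length `N + 1` by their lower neighbours. -/
theorem sum_piAntidiag_succ {n : ℕ} (N : ℕ) (f : (Fin n → ℕ) → Fin n → ℂ)
    (hf : ∀ k i, k i = 0 → f k i = 0) :
    ∑ k ∈ piAntidiag univ (N + 1), ∑ i, f k i
      = ∑ k ∈ piAntidiag univ N, ∑ i, f (k + Pi.single i 1) i := by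
  rw [sum_comm, sum_comm (s := piAntidiag univ N)]
  refine sum_congr rfl fun i _ => ?_
  have e : ∀ k : Fin n → ℕ, k i ≠ 0 → k - Pi.single i 1 + Pi.single i 1 = k := by
    intro k hk
    ext r
    by_cases h : r = i
    · subst h; simp; omega
    · simp [h]
  symm
  -- Points with `k i = 0` have no lower neighbour in direction `i`, but they contribute nothing.
  refine sum_bij_ne_zero (fun k _ _ => k + Pi.single i 1) ?_ ?_ ?_ ?_
  · intro k hk _
    simp only [mem_piAntidiag, mem_univ, implies_true, and_true] at hk ⊢
    simp [sum_add_distrib, hk]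
  · intro k _ _ k' _ _ h
    exact add_right_cancel h
  · intro k hk h0
    have hki : k i ≠ 0 := fun h => h0 (hf k i h)
    refine ⟨k - Pi.single i 1, ?_, ?_, e k hki⟩
    · simp only [mem_piAntidiag, mem_univ, implies_true, and_true] at hk ⊢
      have h2 : ∑ r, (k - Pi.single i 1 + Pi.single i 1 : Fin n → ℕ) r = N + 1 := by
        rw [e k hki, hk]
      simpa [sum_add_distrib] using h2
    · rwa [e k hki]
  · intro k _ _; rfl

/-! ### Vandermonde quotients at shifted points and their lattice steps. -/

/-- The point `x` shifted by the lattice vector `k`. -/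
noncomputable def latticeShift {n : ℕ} (q : ℂ) (x : Fin n → ℂ) (k : Fin n → ℕ) (r : Fin n) : ℂ := x r * q ^ k r

/-- The quotient of Vandermonde products at the shifted point and at `x`. -/
noncomputable def vanRatio {n : ℕ} (q : ℂ) (x : Fin n → ℂ) (k : Fin n → ℕ) : ℂ :=
  ∏ r, ∏ s ∈ Ioi r, (latticeShift q x k s - latticeShift q x k r) / (x s - x r)

/-- Non-degeneracy of the base point `x`. -/
structure AnGeneric {n : ℕ} (q : ℂ) (x : Fin n → ℂ) : Prop where
  q_ne : q ≠ 0
  x_ne : ∀ r, x r ≠ 0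
  inj : Function.Injective x
  pow_ne : ∀ r s (m : ℕ), x r * q ^ (m + 1) ≠ x s

theorem AnGeneric.one_sub_ne {n : ℕ} {q : ℂ} {x : Fin n → ℂ} (h : AnGeneric q x) (r s : Fin n)
    (m : ℕ) : 1 - q * (x r / x s) * q ^ m ≠ 0 := by
  intro h0
  apply h.pow_ne r s m
  have := h.x_ne s
  field_simp at h0
  rw [pow_succ']
  linear_combination (-1 : ℂ) * h0

theorem AnGeneric.qShifted_ne {n : ℕ} {q : ℂ} {x : Fin n → ℂ} (h : AnGeneric q x) (r s : Fin n)
    (m : ℕ) : qShifted q (q * (x r / x s)) m ≠ 0 :=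
  prod_ne_zero_iff.2 fun i _ => h.one_sub_ne r s i

theorem AnGeneric.shift_ne {n : ℕ} {q : ℂ} {x : Fin n → ℂ} (h : AnGeneric q x)
    (k : Fin n → ℕ) (r : Fin n) : latticeShift q x k r ≠ 0 :=
  mul_ne_zero (h.x_ne r) (pow_ne_zero _ h.q_ne)

theorem AnGeneric.shift_inj {n : ℕ} {q : ℂ} {x : Fin n → ℂ} (h : AnGeneric q x)
    (k : Fin n → ℕ) : Function.Injective (latticeShift q x k) := by
  have aux : ∀ r s, k r < k s → latticeShift q x k r ≠ latticeShift q x k s := by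
    intro r s hlt he
    obtain ⟨d, hd⟩ := Nat.exists_eq_add_of_lt hlt
    have hq := pow_ne_zero (k r) h.q_ne
    refine h.pow_ne s r d (mul_right_cancel₀ hq ?_)
    simp only [latticeShift] at he
    rw [he, hd, add_assoc, pow_add]
    ring
  intro r s he
  rcases lt_trichotomy (k r) (k s) with hlt | heq | hgt
  · exact absurd he (aux r s hlt)
  · simp only [latticeShift, heq] at he
    exact h.inj (mul_right_cancel₀ (pow_ne_zero _ h.q_ne) he)
  · exact absurd he.symm (aux s r hgt)

theorem latticeShift_add_single_self {n : ℕ} (q : ℂ) (x : Fin n → ℂ) (k : Fin n → ℕ) (i : Fin n) :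
    latticeShift q x (k + Pi.single i 1) i = q * latticeShift q x k i := by
  simp [latticeShift, pow_succ]; ring

theorem latticeShift_add_single_of_ne {n : ℕ} (q : ℂ) (x : Fin n → ℂ) (k : Fin n → ℕ)
    {i r : Fin n} (h : r ≠ i) :
    latticeShift q x (k + Pi.single i 1) r = latticeShift q x k r := by
  simp [latticeShift, h]

/-- Isolates the pairs containing `i`, the only ones that change in a Vandermonde quotient when the
`i`-th coordinate moves. -/
theorem prod_prod_Ioi_pair {n : ℕ} (i : Fin n) (p : Fin n → ℂ) (c : Fin n → Fin n → ℂ)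
    (h1 : ∀ s, i < s → c i s = p s) (h2 : ∀ r, r < i → c r i = p r)
    (h3 : ∀ r s, r ≠ i → s ≠ i → c r s = 1) :
    ∏ r, ∏ s ∈ Ioi r, c r s = ∏ s ∈ univ.erase i, p s := by
  have hr : ∀ r ∈ univ.erase i, ∏ s ∈ Ioi r, c r s = if r < i then p r else 1 := by
    intro r hr
    have hri := (mem_erase.1 hr).1
    split_ifs with hlt
    · rw [prod_eq_single_of_mem i (mem_Ioi.2 hlt) fun s _ hs => h3 r s hri hs, h2 r hlt]
    · refine prod_eq_one fun s hs => h3 r s hri fun h => hlt (h ▸ mem_Ioi.1 hs)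
  rw [← mul_prod_erase univ _ (mem_univ i), prod_congr rfl hr,
    prod_congr rfl fun s hs => h1 s (mem_Ioi.1 hs)]
  have : ∏ s ∈ Ioi i, p s = ∏ s ∈ univ.erase i, if i < s then p s else 1 := by
    rw [← prod_filter]
    refine prod_congr ?_ fun _ _ => rfl
    ext s
    simp only [mem_Ioi, mem_filter, mem_erase, mem_univ, and_true]
    exact ⟨fun h => ⟨h.ne', h⟩, fun h => h.2⟩
  rw [this, ← prod_mul_distrib]
  refine prod_congr rfl fun s hs => ?_
  rcases lt_or_gt_of_ne (mem_erase.1 hs).1 with h | h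
  · simp [h, h.not_gt]
  · simp [h, h.not_gt]

theorem vanRatio_add_single {n : ℕ} {q : ℂ} {x : Fin n → ℂ} (h : AnGeneric q x)
    (k : Fin n → ℕ) (i : Fin n) :
    vanRatio q x (k + Pi.single i 1) = vanRatio q x k *
      ∏ s ∈ univ.erase i, (q * latticeShift q x k i - latticeShift q x k s)
        / (latticeShift q x k i - latticeShift q x k s) := by
  set v := latticeShift q x k with hv
  set u := latticeShift q x (k + Pi.single i 1) with hu
  have hvi : ∀ r s, r ≠ s → v r - v s ≠ 0 := fun r s hrs =>
    sub_ne_zero.2 fun he => hrs (h.shift_inj k he)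
  have hui : u i = q * v i := latticeShift_add_single_self q x k i
  have hur : ∀ r, r ≠ i → u r = v r := fun r hr => latticeShift_add_single_of_ne q x k hr
  rw [← prod_prod_Ioi_pair i (fun s => (q * v i - v s) / (v i - v s))
    (fun r s => if r = s then 1 else (u s - u r) / (v s - v r))]
  · simp only [vanRatio, ← prod_mul_distrib]
    refine prod_congr rfl fun r _ => prod_congr rfl fun s hs => ?_
    have hrs : r ≠ s := (mem_Ioi.1 hs).ne
    rw [if_neg hrs, ← hu, ← hv]
    have := hvi s r hrs.symm
    field_simp
  · intro s hs
    rw [if_neg hs.ne, hui, hur s hs.ne', ← neg_sub (q * v i), ← neg_sub (v i), neg_div_neg_eq]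
  · intro r hr
    rw [if_neg hr.ne, hui, hur r hr.ne]
  · intro r s hr hs
    split_ifs with hrs
    · rfl
    · rw [hur r hr, hur s hs, div_self (hvi s r (Ne.symm hrs))]

/-- The Vandermonde quotient divided by `∏_{r, s} (q x_r / x_s)_{k_r}`. -/
noncomputable def vanKernel {n : ℕ} (q : ℂ) (x : Fin n → ℂ) (k : Fin n → ℕ) : ℂ :=
  vanRatio q x k / ∏ r, ∏ s, qShifted q (q * (x r / x s)) (k r)

/-- How a product over `r` of functions of `k r` changes when one entry of `k` grows by one. -/
theorem prod_add_single {n : ℕ} (φ : Fin n → ℕ → ℂ) (k : Fin n → ℕ) (i : Fin n) (c : ℂ)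
    (hc : φ i (k i + 1) = φ i (k i) * c) :
    ∏ r, φ r ((k + Pi.single i 1 : Fin n → ℕ) r) = (∏ r, φ r (k r)) * c := by
  rw [← mul_prod_erase univ _ (mem_univ i), ← mul_prod_erase univ (fun r => φ r (k r)) (mem_univ i)]
  have : ∏ r ∈ univ.erase i, φ r ((k + Pi.single i 1 : Fin n → ℕ) r)
      = ∏ r ∈ univ.erase i, φ r (k r) :=
    prod_congr rfl fun r hr => by simp [(mem_erase.1 hr).1]
  rw [this]
  simp only [Pi.add_apply, Pi.single_eq_same]
  rw [hc]; ring

/-- The weight `∏_s (1 - u_i / x_s) / ∏_{s ≠ i} (1 - u_i / u_s)` at the shifted point `u`. -/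
noncomputable def stepWeight {n : ℕ} (q : ℂ) (x : Fin n → ℂ) (k : Fin n → ℕ) (i : Fin n) : ℂ :=
  (∏ s, (1 - latticeShift q x k i / x s))
    / ∏ s ∈ univ.erase i, (1 - latticeShift q x k i / latticeShift q x k s)

/-- The numerator of `stepWeight` at the new point is the factor just gained by the denominator of
`vanKernel`, and its denominator cancels the moved Vandermonde factors. What survives is the partial
fraction denominator at the old point. -/
theorem vanKernel_step {n : ℕ} {q : ℂ} {x : Fin n → ℂ} (h : AnGeneric q x)
    (k : Fin n → ℕ) (i : Fin n) :
    vanKernel q x (k + Pi.single i 1) * stepWeight q x (k + Pi.single i 1) i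
      = vanKernel q x k
        / ∏ s ∈ univ.erase i, (1 - latticeShift q x k i / latticeShift q x k s) := by
  set v := latticeShift q x k with hv
  have hvn := h.shift_ne k
  have hvi : ∀ r s, r ≠ s → v r - v s ≠ 0 := fun r s hrs =>
    sub_ne_zero.2 fun he => hrs (h.shift_inj k he)
  have hui := latticeShift_add_single_self q x k i
  have hun := h.shift_ne (k + Pi.single i 1)
  have huinj := h.shift_inj (k + Pi.single i 1)
  have e1 : ∏ r, ∏ s, qShifted q (q * (x r / x s)) ((k + Pi.single i 1 : Fin n → ℕ) r)
      = (∏ r, ∏ s, qShifted q (q * (x r / x s)) (k r)) * ∏ s, (1 - q * v i / x s) := by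
    refine prod_add_single (fun r m => ∏ s, qShifted q (q * (x r / x s)) m) k i _ ?_
    simp only [qShifted_succ, prod_mul_distrib]
    congr 1
    refine prod_congr rfl fun s _ => ?_
    simp only [hv, latticeShift]; ring
  have hP : ∏ s, (1 - q * v i / x s) ≠ 0 := by
    refine prod_ne_zero_iff.2 fun s _ => ?_
    have := h.one_sub_ne i s (k i)
    convert this using 2
    simp only [hv, latticeShift]; ring
  have e2 : ∏ s ∈ univ.erase i, (1 - latticeShift q x (k + Pi.single i 1) i
        / latticeShift q x (k + Pi.single i 1) s)
      = ∏ s ∈ univ.erase i, (1 - q * v i / v s) := by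
    refine prod_congr rfl fun s hs => ?_
    rw [hui, latticeShift_add_single_of_ne q x k (mem_erase.1 hs).1]
  have hQ : ∏ s ∈ univ.erase i, (1 - q * v i / v s) ≠ 0 := by
    rw [← e2]
    refine prod_ne_zero_iff.2 fun s hs h0 => ?_
    have := hun s
    rw [sub_eq_zero, eq_comm, div_eq_one_iff_eq this] at h0
    exact (mem_erase.1 hs).1 (huinj h0).symm
  have e3 : ∏ s ∈ univ.erase i, (q * v i - v s) / (v i - v s)
      = (∏ s ∈ univ.erase i, (1 - q * v i / v s)) / ∏ s ∈ univ.erase i, (1 - v i / v s) := by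
    rw [← prod_div_distrib]
    refine prod_congr rfl fun s hs => ?_
    have h1 := hvi i s (mem_erase.1 hs).1.symm
    have h2 : v s - v i ≠ 0 := hvi s i (mem_erase.1 hs).1
    have h3 : v s ≠ 0 := hvn s
    have e' : 1 - v i / v s = (v s - v i) / v s := by field_simp
    rw [e', ← neg_sub (v s) (v i)]
    field_simp; ring
  simp only [vanKernel, stepWeight]
  rw [vanRatio_add_single h, ← hv, e1, e2, hui, e3]
  generalize (∏ s, (1 - q * v i / x s)) = P at *
  generalize ∏ s ∈ univ.erase i, (1 - q * v i / v s) = Q at *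
  field_simp

theorem prod_add_single_mul {n : ℕ} (φ : Fin n → ℕ → ℂ) (k : Fin n → ℕ) (i : Fin n) (c d : ℂ)
    (hc : φ i (k i + 1) * c = φ i (k i) * d) :
    (∏ r, φ r ((k + Pi.single i 1 : Fin n → ℕ) r)) * c = (∏ r, φ r (k r)) * d := by
  rw [← mul_prod_erase univ _ (mem_univ i), ← mul_prod_erase univ (fun r => φ r (k r)) (mem_univ i)]
  have : ∏ r ∈ univ.erase i, φ r ((k + Pi.single i 1 : Fin n → ℕ) r)
      = ∏ r ∈ univ.erase i, φ r (k r) :=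
    prod_congr rfl fun r hr => by simp [(mem_erase.1 hr).1]
  rw [this]
  simp only [Pi.add_apply, Pi.single_eq_same]
  linear_combination (∏ r ∈ univ.erase i, φ r (k r)) * hc

/-! ### Closed form of the level sums. -/

/-- The product `∏_{r, s} (q ^ (-k_s) x_r / x_s)_{j_r}`. -/
noncomputable def backFactor {n : ℕ} (q : ℂ) (x : Fin n → ℂ) (k j : Fin n → ℕ) : ℂ :=
  ∏ s, ∏ r, qShifted q (x r / latticeShift q x k s) (j r)

/-- The diagonal factor `(q^(-k_s))_{j_s}` terminates. Hence `backFactor` is triangular: it is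
supported on `j ≤ k`. -/
theorem backFactor_eq_zero {n : ℕ} {q : ℂ} {x : Fin n → ℂ} (h : AnGeneric q x)
    {k j : Fin n → ℕ} {s : Fin n} (hs : k s < j s) : backFactor q x k j = 0 := by
  refine prod_eq_zero (mem_univ s) (prod_eq_zero (mem_univ s) ?_)
  refine prod_eq_zero (mem_range.2 hs) ?_
  have h1 := h.x_ne s
  have h2 := pow_ne_zero (k s) h.q_ne
  simp only [latticeShift]
  field_simp
  simp

theorem qShifted_div_step (q y : ℂ) (hq : q ≠ 0) (hy : y ≠ 0) (m : ℕ) :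
    qShifted q (y / q) m * (1 - q / (y * q ^ m)) = qShifted q y m * ((q ^ m)⁻¹ * (1 - q / y)) := by
  have h := qShifted_shift q (y / q) m
  rw [div_mul_cancel₀ y hq] at h
  have hm := pow_ne_zero m hq
  have e1 : 1 - q / (y * q ^ m) = (1 - y / q * q ^ m) * (-q / (y * q ^ m)) := by
    field_simp; ring
  rw [e1, ← mul_assoc, h]
  field_simp; ring

/-- Kept in cross-multiplied form because the factor on the left vanishes when `k i + 1 = j i`. -/
theorem backFactor_step {n : ℕ} {q : ℂ} {x : Fin n → ℂ} (h : AnGeneric q x)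
    (k j : Fin n → ℕ) (i : Fin n) :
    backFactor q x (k + Pi.single i 1) j
        * ∏ s, (1 - q * latticeShift q x k i / latticeShift q x j s)
      = backFactor q x k j * ((q ^ ∑ s, j s)⁻¹ * ∏ s, (1 - q * latticeShift q x k i / x s)) := by
  refine prod_add_single_mul
    (fun s m => ∏ r, qShifted q (x r / (x s * q ^ m)) (j r)) k i _ _ ?_
  rw [← prod_pow_eq_pow_sum, ← prod_inv_distrib, ← prod_mul_distrib, ← prod_mul_distrib,
    ← prod_mul_distrib]
  refine prod_congr rfl fun r _ => ?_
  have hq := h.q_ne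
  have hr := h.x_ne r
  have hi := h.x_ne i
  have hk := pow_ne_zero (k i) hq
  have := qShifted_div_step q (x r / (x i * q ^ k i)) hq (by positivity) (j r)
  convert this using 2
  · congr 1; rw [pow_succ]; field_simp
  · simp only [latticeShift]; field_simp
  · congr 1; simp only [latticeShift]; field_simp

/-- The term of the level sum behind the fundamental summation. -/
noncomputable def levelTerm {n : ℕ} (q a : ℂ) (x : Fin n → ℂ) (j k : Fin n → ℕ) : ℂ :=
  vanKernel q x k * backFactor q x k j * ∏ r, ∏ s, qShifted q (a * (x r / x s)) (k r)

theorem levelTerm_step {n : ℕ} {q a : ℂ} {x : Fin n → ℂ} (h : AnGeneric q x)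
    (j k : Fin n → ℕ) (i : Fin n) :
    levelTerm q a x j (k + Pi.single i 1)
        * ((∏ s, (1 - latticeShift q x (k + Pi.single i 1) i / latticeShift q x j s))
          / ∏ s ∈ univ.erase i, (1 - latticeShift q x (k + Pi.single i 1) i
              / latticeShift q x (k + Pi.single i 1) s))
      = (q ^ ∑ s, j s)⁻¹ * levelTerm q a x j k
        * ((∏ s, (1 - a * q ^ k s * latticeShift q x k i / latticeShift q x k s))
          / ∏ s ∈ univ.erase i, (1 - latticeShift q x k i / latticeShift q x k s)) := by
  have h1 := vanKernel_step h k i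
  have h2 := backFactor_step h k j i
  have h3 : ∏ r, ∏ s, qShifted q (a * (x r / x s)) ((k + Pi.single i 1 : Fin n → ℕ) r)
      = (∏ r, ∏ s, qShifted q (a * (x r / x s)) (k r))
        * ∏ s, (1 - a * q ^ k s * latticeShift q x k i / latticeShift q x k s) := by
    refine prod_add_single (fun r m => ∏ s, qShifted q (a * (x r / x s)) m) k i _ ?_
    simp only [qShifted_succ, prod_mul_distrib]
    congr 1
    refine prod_congr rfl fun s _ => ?_
    have hs := h.x_ne s
    have hk := pow_ne_zero (k s) h.q_ne
    simp only [latticeShift]; field_simp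
  simp only [levelTerm, h3]
  simp only [stepWeight, latticeShift_add_single_self] at h1 ⊢
  generalize ∏ s, (1 - q * latticeShift q x k i / x s) = P at *
  generalize ∏ s, (1 - q * latticeShift q x k i / latticeShift q x j s) = P' at *
  generalize ∏ s, (1 - a * q ^ k s * latticeShift q x k i / latticeShift q x k s) = T at *
  generalize ∏ s ∈ univ.erase i, (1 - q * latticeShift q x k i
    / latticeShift q x (k + Pi.single i 1) s) = Q at *
  generalize ∏ s ∈ univ.erase i, (1 - latticeShift q x k i / latticeShift q x k s) = R at *
  generalize ∏ r, ∏ s, qShifted q (a * (x r / x s)) (k r) = N at *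
  generalize vanKernel q x (k + Pi.single i 1) = E' at *
  generalize vanKernel q x k = E at *
  simp only [div_eq_mul_inv] at h1 ⊢
  linear_combination (E' * N * T * Q⁻¹) * h2
    + (backFactor q x k j * (q ^ ∑ s, j s)⁻¹ * N * T) * h1

/-- Both scalar factors are partial fraction sums over directions, at level `K + 1` with `t s = q^(k
s - j s)` and at level `K` with `t s = a q^(k s)`. `levelTerm_step` matches them summand by summand
after reindexing. -/
theorem sum_levelTerm_succ {n : ℕ} {q : ℂ} (a : ℂ) {x : Fin n → ℂ} (h : AnGeneric q x)
    (j : Fin n → ℕ) (K : ℕ) :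
    (1 - q ^ (K + 1) / q ^ ∑ s, j s) * ∑ k ∈ piAntidiag univ (K + 1), levelTerm q a x j k
      = (q ^ ∑ s, j s)⁻¹ * (1 - a ^ n * q ^ K)
        * ∑ k ∈ piAntidiag univ K, levelTerm q a x j k := by
  have hs := sum_piAntidiag_succ K (fun k i => levelTerm q a x j k
    * ((∏ s, (1 - latticeShift q x k i / latticeShift q x j s))
      / ∏ s ∈ univ.erase i, (1 - latticeShift q x k i / latticeShift q x k s))) ?_
  · rw [mul_sum, mul_sum]
    refine Eq.trans (sum_congr rfl fun k hk => ?_) (hs.trans (sum_congr rfl fun k hk => ?_))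
    · rw [← mul_sum]
      have hP := sum_prod_div (latticeShift q x k) (fun s => q ^ k s / q ^ j s) (h.shift_ne k)
        (h.shift_inj k)
      have hk' : ∑ s, k s = K + 1 := by simpa using hk
      rw [prod_div_distrib, prod_pow_eq_pow_sum, prod_pow_eq_pow_sum, hk'] at hP
      rw [← hP, mul_comm]
      congr 1
      refine sum_congr rfl fun i _ => ?_
      congr 1
      refine prod_congr rfl fun s _ => ?_
      have hs := h.x_ne s
      have hq1 := pow_ne_zero (k s) h.q_ne
      have hq2 := pow_ne_zero (j s) h.q_ne
      simp only [latticeShift]; field_simp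
    · simp only [levelTerm_step h]
      rw [← mul_sum, sum_prod_div (latticeShift q x k) (fun s => a * q ^ k s) (h.shift_ne k)
        (h.shift_inj k)]
      have hk' : ∑ s, k s = K := by simpa using hk
      rw [prod_mul_distrib, prod_pow_eq_pow_sum, hk']
      simp only [prod_const, card_univ, Fintype.card_fin]
      ring
  · intro k i hki
    -- Boundary terms `k i = 0`: the weight vanishes if `j i = 0`, and otherwise triangularity kills
    -- `levelTerm`.
    rcases Nat.eq_zero_or_pos (j i) with hj | hj
    · have : ∏ s, (1 - latticeShift q x k i / latticeShift q x j s) = 0 := by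
        refine prod_eq_zero (mem_univ i) ?_
        have := h.x_ne i
        simp [latticeShift, hki, hj, this]
      rw [this]; simp
    · simp [levelTerm, backFactor_eq_zero h (hki ▸ hj : k i < j i)]

theorem exists_lt_of_sum_eq {n : ℕ} {k j : Fin n → ℕ} (hs : ∑ s, k s ≤ ∑ s, j s) (hne : k ≠ j) :
    ∃ s, k s < j s := by
  by_contra! hle
  have h2 := (sum_eq_sum_iff_of_le fun i _ => hle i).1 (le_antisymm (sum_le_sum fun i _ => hle i) hs)
  exact hne (funext fun i => (h2 i (mem_univ i)).symm)

theorem sum_backFactor_diag {n : ℕ} {q : ℂ} {x : Fin n → ℂ} (h : AnGeneric q x)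
    (j : Fin n → ℕ) (f : (Fin n → ℕ) → ℂ)
    (hf : ∀ k, backFactor q x k j = 0 → f k = 0) :
    ∑ k ∈ piAntidiag univ (∑ s, j s), f k = f j := by
  refine sum_eq_single j (fun k hk hne => ?_) fun hj => absurd (by simp) hj
  have hk' : ∑ s, k s = ∑ s, j s := by simpa using hk
  obtain ⟨s, hs⟩ := exists_lt_of_sum_eq hk'.le hne
  exact hf k (backFactor_eq_zero h hs)

/-- Iterates the recurrence upward from level `|j|`, where triangularity leaves only `k = j`. -/
theorem sum_levelTerm {n : ℕ} {q : ℂ} (a : ℂ) {x : Fin n → ℂ} (h : AnGeneric q x)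
    (j : Fin n → ℕ) (m : ℕ) :
    (∑ k ∈ piAntidiag univ ((∑ s, j s) + m), levelTerm q a x j k)
        * (q ^ ((∑ s, j s) * m) * qShifted q q m)
      = levelTerm q a x j j * qShifted q (a ^ n * q ^ ∑ s, j s) m := by
  induction m with
  | zero =>
    rw [add_zero, sum_backFactor_diag h j _ fun k hk => by simp [levelTerm, hk]]
    simp [qShifted_zero]
  | succ m ih =>
    have hs := sum_levelTerm_succ a h j ((∑ s, j s) + m)
    generalize hJ : ∑ s, j s = J at *
    have hqJ := pow_ne_zero J h.q_ne
    have e : q ^ (J + m + 1) / q ^ J = q ^ (m + 1) := by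
      rw [add_assoc, pow_add]; field_simp
    rw [e] at hs
    rw [qShifted_succ, qShifted_succ, ← mul_assoc (levelTerm q a x j j), ← ih, ← add_assoc,
      Nat.mul_succ, pow_add, ← pow_succ']
    have e3 : 1 - a ^ n * q ^ J * q ^ m = 1 - a ^ n * q ^ (J + m) := by rw [pow_add]; ring
    rw [e3]
    have hs' := congrArg (fun t => q ^ J * t) hs
    simp only [← mul_assoc] at hs'
    rw [mul_inv_cancel₀ hqJ] at hs'
    linear_combination (q ^ (J * m) * qShifted q q m) * hs'

/-! ### The multidimensional terminating `q`-Chu–Vandermonde expansion. -/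

/-- The sum over lattice points of length `m` in the terminating Chu–Vandermonde expansion. -/
noncomputable def chuSum {n : ℕ} (q c : ℂ) (x : Fin n → ℂ) (k : Fin n → ℕ) (m : ℕ) : ℂ :=
  ∑ j ∈ piAntidiag univ m,
    vanKernel q x j * backFactor q x k j / ∏ i, qShifted q (c * x i) (j i)

theorem stepWeight_eq {n : ℕ} {q : ℂ} {x : Fin n → ℂ} (h : AnGeneric q x) (j : Fin n → ℕ)
    (i : Fin n) : stepWeight q x j i
      = (∏ s, (1 - q ^ j s * latticeShift q x j i / latticeShift q x j s))
        / ∏ s ∈ univ.erase i, (1 - latticeShift q x j i / latticeShift q x j s) := by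
  simp only [stepWeight]
  congr 1
  refine prod_congr rfl fun s _ => ?_
  have := h.x_ne s
  have := pow_ne_zero (j s) h.q_ne
  simp only [latticeShift]; field_simp

/-- Split `1 - c u_i / q = (1 - c W / q) + (c W / q)(1 - u_i / W)`. The first part is the partial
fraction formula at `ζ = W⁻¹`; in the second the product becomes complete and the formula at `ζ = 0`
applies. -/
theorem sum_stepWeight_mul {n : ℕ} {q : ℂ} {x : Fin n → ℂ} (h : AnGeneric q x) (j : Fin n → ℕ)
    (c W : ℂ) (hW : W ≠ 0) :
    ∑ i, stepWeight q x j i * (1 - c * latticeShift q x j i / q)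
        * ∏ r ∈ univ.erase i, (1 - latticeShift q x j r / W)
      = (1 - c * W * q ^ (∑ s, j s) / q) * ∏ r, (1 - latticeShift q x j r / W)
        - q ^ (∑ s, j s) * (1 - c * W / q) * ∏ r, (1 - x r / W) := by
  have h1 := sum_prod_div_mul_prod (latticeShift q x j) (fun s => q ^ j s) (h.shift_ne j)
    (h.shift_inj j) W⁻¹
  have h2 := sum_prod_div (latticeShift q x j) (fun s => q ^ j s) (h.shift_ne j) (h.shift_inj j)
  simp only [← stepWeight_eq h, prod_pow_eq_pow_sum, ← div_eq_mul_inv] at h1 h2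
  have h3 : ∏ r, (q ^ j r - latticeShift q x j r / W)
      = q ^ (∑ s, j s) * ∏ r, (1 - x r / W) := by
    rw [← prod_pow_eq_pow_sum, ← prod_mul_distrib]
    refine prod_congr rfl fun r _ => ?_
    simp only [latticeShift]; ring
  rw [h3] at h1
  have h4 : ∀ i, stepWeight q x j i * (1 - c * latticeShift q x j i / q)
        * ∏ r ∈ univ.erase i, (1 - latticeShift q x j r / W)
      = (1 - c * W / q) * (stepWeight q x j i
          * ∏ r ∈ univ.erase i, (1 - latticeShift q x j r / W))
        + (c * W / q * ∏ r, (1 - latticeShift q x j r / W)) * stepWeight q x j i := by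
    intro i
    rw [← mul_prod_erase univ _ (mem_univ i)]
    field_simp; ring
  rw [sum_congr rfl fun i _ => h4 i, sum_add_distrib, ← mul_sum, ← mul_sum, h1, h2]
  ring

/-- The two sums at level `m + 1` are combined so that, point by point, their difference is a
weighted sum over directions; pushing each direction down one step leaves the sum at level `m`. -/
theorem chuSum_step {n : ℕ} {q c : ℂ} {x : Fin n → ℂ} (h : AnGeneric q x)
    (hc : ∀ i, ∀ m : ℕ, qShifted q (c * x i) m ≠ 0) (k : Fin n → ℕ) (o : Fin n) (m : ℕ) :
    q ^ (m + 1) * (1 - c * latticeShift q x k o) * chuSum q c x (k + Pi.single o 1) (m + 1)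
      = (1 - c * latticeShift q x k o * q ^ (m + 1)) * chuSum q c x k (m + 1)
        - chuSum q c x k m := by
  have hq := h.q_ne
  set w := latticeShift q x k o with hw
  -- `W` is the moved coordinate of `k + e_o`. The values of `backFactor` at `k` and `k + e_o` share
  -- `X' * M` and differ only in `∏ (1 - u_r / W)` versus `∏ (1 - x_r / W)`.
  set W := q * w with hWdef
  have hw0 : w ≠ 0 := h.shift_ne k o
  have hW : W ≠ 0 := mul_ne_zero hq hw0
  have hth : ∀ r, 1 - x r / W ≠ 0 := by
    intro r h0
    rw [sub_eq_zero, eq_comm, div_eq_one_iff_eq hW] at h0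
    refine h.pow_ne o r (k o) ?_
    rw [h0, hWdef, hw, latticeShift, pow_succ]; ring
  let C : (Fin n → ℕ) → ℂ := fun j => ∏ i, qShifted q (c * x i) (j i)
  let X' : (Fin n → ℕ) → ℂ := fun j =>
    ∏ s ∈ univ.erase o, ∏ r, qShifted q (x r / latticeShift q x k s) (j r)
  let M : (Fin n → ℕ) → ℂ := fun j => ∏ r, qShifted q (x r / W) (j r) / (1 - x r / W)
  have hX1 : ∀ j, backFactor q x k j = X' j * M j * ∏ r, (1 - latticeShift q x j r / W) := by
    intro j
    rw [backFactor, ← mul_prod_erase univ _ (mem_univ o), mul_comm, mul_assoc]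
    congr 1
    rw [← prod_mul_distrib]
    refine prod_congr rfl fun r _ => ?_
    have e := qShifted_shift q (x r / W) (j r)
    have e1 : x r / W * q = x r / latticeShift q x k o := by rw [hWdef, ← hw]; field_simp
    have e2 : latticeShift q x j r / W = x r / W * q ^ j r := by simp only [latticeShift]; ring
    rw [e1] at e
    rw [e2, div_mul_eq_mul_div, e, mul_div_cancel_left₀ _ (hth r)]
  have hX2 : ∀ j, backFactor q x (k + Pi.single o 1) j = X' j * M j * ∏ r, (1 - x r / W) := by
    intro j
    rw [backFactor, ← mul_prod_erase univ _ (mem_univ o), mul_comm, mul_assoc]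
    congr 1
    · refine prod_congr rfl fun s hs => ?_
      rw [latticeShift_add_single_of_ne q x k (mem_erase.1 hs).1]
    · rw [← prod_mul_distrib]
      refine prod_congr rfl fun r _ => ?_
      rw [latticeShift_add_single_self, div_mul_cancel₀ _ (hth r)]
  have hflow := sum_piAntidiag_succ m (fun j i => vanKernel q x j / C j * X' j * M j
    * (stepWeight q x j i * (1 - c * latticeShift q x j i / q)
        * ∏ r ∈ univ.erase i, (1 - latticeShift q x j r / W))) ?_
  · have hl : ∑ j ∈ piAntidiag univ (m + 1), ∑ i, vanKernel q x j / C j * X' j * M j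
          * (stepWeight q x j i * (1 - c * latticeShift q x j i / q)
            * ∏ r ∈ univ.erase i, (1 - latticeShift q x j r / W))
        = (1 - c * w * q ^ (m + 1)) * chuSum q c x k (m + 1)
          - q ^ (m + 1) * (1 - c * w) * chuSum q c x (k + Pi.single o 1) (m + 1) := by
      rw [chuSum, chuSum, mul_sum, mul_sum, ← sum_sub_distrib]
      refine sum_congr rfl fun j hj => ?_
      have hj' : ∑ s, j s = m + 1 := by simpa using hj
      rw [← mul_sum, sum_stepWeight_mul h j c W hW, hX1, hX2, hj']
      have e1 : c * W / q = c * w := by rw [hWdef]; field_simp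
      have e2 : c * W * q ^ (m + 1) / q = c * w * q ^ (m + 1) := by rw [hWdef]; field_simp
      rw [e1, e2]
      simp only [C]
      ring
    have hr : ∀ j, ∑ i, vanKernel q x (j + Pi.single i 1) / C (j + Pi.single i 1)
          * X' (j + Pi.single i 1) * M (j + Pi.single i 1)
          * (stepWeight q x (j + Pi.single i 1) i
            * (1 - c * latticeShift q x (j + Pi.single i 1) i / q)
            * ∏ r ∈ univ.erase i, (1 - latticeShift q x (j + Pi.single i 1) r / W))
        = vanKernel q x j * backFactor q x k j / C j := by
      intro j
      set v := latticeShift q x j with hv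
      -- Setting `t o = 0` removes the factor indexed by `o` and makes the total weight exactly `1`.
      have hPF := sum_prod_div v (fun s => if s = o then 0 else v s / latticeShift q x k s)
        (h.shift_ne j) (h.shift_inj j)
      have h0 : ∏ s, (if s = o then 0 else v s / latticeShift q x k s) = 0 :=
        prod_eq_zero (mem_univ o) (if_pos rfl)
      rw [h0, sub_zero] at hPF
      have hmul := congrArg (fun t => vanKernel q x j * backFactor q x k j / C j * t) hPF
      simp only [mul_one] at hmul
      rw [← hmul, mul_sum]
      refine sum_congr rfl fun i _ => ?_
      have hE := vanKernel_step h j i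
      have hC : C (j + Pi.single i 1) = C j * (1 - c * v i) :=
        prod_add_single (fun i m => qShifted q (c * x i) m) j i _
          (by simp only [qShifted_succ, hv, latticeShift]; ring)
      have hCne : C (j + Pi.single i 1) ≠ 0 := prod_ne_zero_iff.2 fun s _ => hc s _
      have hX : X' (j + Pi.single i 1)
          = X' j * ∏ s ∈ univ.erase o, (1 - v i / latticeShift q x k s) := by
        simp only [X']
        rw [← prod_mul_distrib]
        refine prod_congr rfl fun s _ => ?_
        refine prod_add_single (fun r m => qShifted q (x r / latticeShift q x k s) m) j i _ ?_
        simp only [qShifted_succ, hv, latticeShift]; ring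
      have hM : M (j + Pi.single i 1) = M j * (1 - v i / W) := by
        refine prod_add_single (fun r m => qShifted q (x r / W) m / (1 - x r / W)) j i _ ?_
        simp only [qShifted_succ, hv, latticeShift]; ring
      have hu : c * latticeShift q x (j + Pi.single i 1) i / q = c * v i := by
        rw [latticeShift_add_single_self, ← hv]; field_simp
      have hU : ∏ r ∈ univ.erase i, (1 - latticeShift q x (j + Pi.single i 1) r / W)
          = ∏ r ∈ univ.erase i, (1 - v r / W) :=
        prod_congr rfl fun r hr => by rw [latticeShift_add_single_of_ne q x j (mem_erase.1 hr).1]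
      have hT : ∏ s, (1 - (if s = o then 0 else v s / latticeShift q x k s) * v i / v s)
          = ∏ s ∈ univ.erase o, (1 - v i / latticeShift q x k s) := by
        rw [← mul_prod_erase univ _ (mem_univ o), if_pos rfl, zero_mul, zero_div, sub_zero, one_mul]
        refine prod_congr rfl fun s hs => ?_
        have : v s ≠ 0 := h.shift_ne j s
        rw [if_neg (mem_erase.1 hs).1]
        field_simp
      rw [hC] at hCne
      have hC1 := left_ne_zero_of_mul hCne
      have hC2 := right_ne_zero_of_mul hCne
      rw [hX1, ← mul_prod_erase univ (fun r => 1 - v r / W) (mem_univ i), hC, hX, hM, hu, hU, hT]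
      generalize ∏ r ∈ univ.erase i, (1 - v r / W) = U at *
      generalize ∏ s ∈ univ.erase o, (1 - v i / latticeShift q x k s) = T at *
      generalize ∏ s ∈ univ.erase i, (1 - v i / v s) = R at *
      generalize vanKernel q x (j + Pi.single i 1) = E' at *
      generalize stepWeight q x (j + Pi.single i 1) i = S at *
      have e : E' / (C j * (1 - c * v i)) * (X' j * T) * (M j * (1 - v i / W))
          * (S * (1 - c * v i) * U)
          = E' * S / C j * (X' j * T) * (M j * (1 - v i / W)) * U := by
        field_simp
      rw [e, hE]
      ring
    rw [hl, sum_congr rfl fun j _ => hr j] at hflow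
    rw [sub_eq_iff_eq_add] at hflow
    have hD : chuSum q c x k m
        = ∑ j ∈ piAntidiag univ m, vanKernel q x j * backFactor q x k j / C j := rfl
    rw [hflow, hD]
    ring
  · intro j i hji
    have : stepWeight q x j i = 0 := by
      rw [stepWeight, prod_eq_zero (mem_univ i), zero_div]
      have := h.x_ne i
      simp [latticeShift, hji, this]
    simp [this]

theorem lattice_induction {n : ℕ} {motive : (Fin n → ℕ) → Prop} (zero : motive 0)
    (step : ∀ k i, motive k → motive (k + Pi.single i 1)) (k : Fin n → ℕ) : motive k := by
  induction hK : ∑ s, k s generalizing k with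
  | zero =>
    have : k = 0 := funext fun s => (sum_eq_zero_iff.1 hK) s (mem_univ s)
    rwa [this]
  | succ K ih =>
    obtain ⟨i, hi⟩ : ∃ i, k i ≠ 0 := by
      by_contra! h
      simp [h] at hK
    have e : k - Pi.single i 1 + Pi.single i 1 = k := by
      ext r
      by_cases h : r = i
      · subst h; simp; omega
      · simp [h]
    have h2 : ∑ r, (k - Pi.single i 1 + Pi.single i 1 : Fin n → ℕ) r = K + 1 := by rw [e, hK]
    rw [← e]
    refine step _ i (ih _ ?_)
    simpa [sum_add_distrib] using h2

theorem vanKernel_zero {n : ℕ} {q : ℂ} {x : Fin n → ℂ} (h : AnGeneric q x) :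
    vanKernel q x 0 = 1 := by
  simp only [vanKernel, vanRatio, latticeShift, Pi.zero_apply, pow_zero, mul_one, qShifted_zero,
    prod_const_one, div_one]
  refine prod_eq_one fun r _ => prod_eq_one fun s hs => div_self ?_
  exact sub_ne_zero.2 fun he => (mem_Ioi.1 hs).ne (h.inj he).symm

theorem chuSum_zero {n : ℕ} {q c : ℂ} {x : Fin n → ℂ} (h : AnGeneric q x) (k : Fin n → ℕ) :
    chuSum q c x k 0 = 1 := by
  simp [chuSum, vanKernel_zero h, backFactor, qShifted_zero]

theorem chuSum_eq_zero {n : ℕ} {q c : ℂ} {x : Fin n → ℂ} (h : AnGeneric q x) (k : Fin n → ℕ)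
    {m : ℕ} (hm : ∑ s, k s < m) : chuSum q c x k m = 0 := by
  refine sum_eq_zero fun j hj => ?_
  have hj' : ∑ s, j s = m := by simpa using hj
  obtain ⟨s, hs⟩ := exists_lt_of_sum_eq (k := k) (j := j) (by omega) (by rintro rfl; omega)
  rw [backFactor_eq_zero h hs]; simp

theorem chuSum_zero_diag {n : ℕ} {q : ℂ} {x : Fin n → ℂ} (h : AnGeneric q x) (k : Fin n → ℕ) :
    chuSum q 0 x k (∑ s, k s) = vanKernel q x k * backFactor q x k k := by
  rw [chuSum, sum_eq_single k]
  · simp [qShifted]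
  · intro j hj hne
    have hj' : ∑ s, j s = ∑ s, k s := by simpa using hj
    obtain ⟨s, hs⟩ := exists_lt_of_sum_eq hj'.ge hne.symm
    rw [backFactor_eq_zero h hs]; simp
  · intro hk; exact absurd (by simp) hk

/-- For `c = 0` the sum at level `|k|` is this diagonal term and the sum at level `|k| + 1`
vanishes. So `chuSum_step` says that a lattice step multiplies the term by `-q^(-(|k|+1))`, and no
product has to be evaluated. -/
theorem vanKernel_mul_backFactor {n : ℕ} {q : ℂ} {x : Fin n → ℂ} (h : AnGeneric q x)
    (k : Fin n → ℕ) :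
    vanKernel q x k * backFactor q x k k * ((-1) ^ (∑ s, k s) * q ^ (∑ s, k s + 1).choose 2)
      = 1 := by
  rw [← chuSum_zero_diag h]
  induction k using lattice_induction with
  | zero => simp [chuSum_zero h]
  | step k i ih =>
    have hs := chuSum_step (c := 0) h (fun i m => by simp [qShifted]) k i (∑ s, k s)
    have e : ∑ s, (k + Pi.single i 1 : Fin n → ℕ) s = ∑ s, k s + 1 := by
      simp [sum_add_distrib]
    rw [chuSum_eq_zero h k (Nat.lt_succ_self _)] at hs
    rw [e, Nat.choose_succ_succ' (_ + 1) 1, Nat.choose_one_right, pow_add, pow_succ (-1 : ℂ)]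
    simp only [zero_mul, sub_zero, mul_one, mul_zero, zero_sub] at hs
    linear_combination (-((-1) ^ (∑ s, k s) * q ^ (∑ s, k s + 1).choose 2)) * hs + ih

/-- The product `∏_i ∏_{m < k_i} (y - c x_i q ^ m) / (1 - c x_i q ^ m)`. -/
noncomputable def chuPoly {n : ℕ} (q c : ℂ) (x : Fin n → ℂ) (k : Fin n → ℕ) (y : ℂ) : ℂ :=
  ∏ i, (∏ m ∈ range (k i), (y - c * x i * q ^ m)) / qShifted q (c * x i) (k i)

/-- A multidimensional terminating `q`-Chu–Vandermonde expansion. -/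
theorem sum_chuSum {n : ℕ} {q c : ℂ} {x : Fin n → ℂ} (h : AnGeneric q x)
    (hc : ∀ i, ∀ m : ℕ, qShifted q (c * x i) m ≠ 0) (y : ℂ) (k : Fin n → ℕ) :
    ∀ N, ∑ s, k s ≤ N →
      ∑ m ∈ range (N + 1), q ^ m * chuSum q c x k m * qShifted q y m = chuPoly q c x k y := by
  induction k using lattice_induction with
  | zero =>
    intro N _
    rw [sum_range_succ', sum_eq_zero]
    · simp [chuSum_zero h, qShifted_zero, chuPoly]
    · intro m _
      rw [chuSum_eq_zero h 0 (by simp)]; simp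
  | step k i ih =>
    intro N hN
    have e : ∑ s, (k + Pi.single i 1 : Fin n → ℕ) s = ∑ s, k s + 1 := by
      simp [sum_add_distrib]
    obtain ⟨N, rfl⟩ : ∃ N', N = N' + 1 := ⟨N - 1, by omega⟩
    have hkN : ∑ s, k s ≤ N := by omega
    set w := latticeShift q x k i with hw
    have hcw : 1 - c * w ≠ 0 := by
      have := hc i (k i + 1)
      rw [qShifted_succ] at this
      have := right_ne_zero_of_mul this
      rwa [hw, latticeShift, ← mul_assoc]
    have hP : chuPoly q c x (k + Pi.single i 1) y
        = chuPoly q c x k y * ((y - c * w) / (1 - c * w)) := by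
      refine prod_add_single
        (fun i m => (∏ m ∈ range m, (y - c * x i * q ^ m)) / qShifted q (c * x i) m) k i _ ?_
      simp only [prod_range_succ, qShifted_succ, hw, latticeShift]
      rw [mul_div_mul_comm]
      simp only [mul_assoc]
    rw [hP, ← mul_div_assoc, eq_div_iff hcw, ← ih N hkN, sum_range_succ', add_mul, sum_mul]
    -- After shifting the index in the first part, the coefficient of `chuSum q c x k m` is `(1 - c
    -- w q^m)(y)_m - (y)_{m+1} = q^m (y)_m (y - c w)`, which is the required extra factor.
    have h1 : ∀ m, q ^ (m + 1) * chuSum q c x (k + Pi.single i 1) (m + 1) * qShifted q y (m + 1)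
          * (1 - c * w)
        = (1 - c * w * q ^ (m + 1)) * chuSum q c x k (m + 1) * qShifted q y (m + 1)
          - chuSum q c x k m * qShifted q y (m + 1) := by
      intro m
      linear_combination qShifted q y (m + 1) * chuSum_step h hc k i m
    have h2 := sum_range_succ'
      (fun m => (1 - c * w * q ^ m) * chuSum q c x k m * qShifted q y m) (N + 1)
    have h3 := sum_range_succ
      (fun m => (1 - c * w * q ^ m) * chuSum q c x k m * qShifted q y m) (N + 1)
    simp only [chuSum_eq_zero h k (Nat.lt_succ_of_le hkN), mul_zero, zero_mul, add_zero] at h3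
    rw [h3] at h2
    simp only [chuSum_zero h, pow_zero, mul_one, one_mul, qShifted_zero] at h2 ⊢
    rw [sum_congr rfl fun m _ => h1 m, sum_sub_distrib, sub_add_eq_add_sub, ← h2,
      ← sum_sub_distrib, sum_mul]
    refine sum_congr rfl fun m _ => ?_
    rw [qShifted_succ]
    ring

/-! ### Exchange of the two multi-index sums on one level. -/

/-- The one-dimensional summand left over after summing over all lattice points of given
length. -/
noncomputable def rogersTerm (q B Z : ℂ) (J m : ℕ) : ℂ :=
  qShifted q B m * qShifted q (B * Z * q ^ m) J * (1 - B * Z * q ^ (J + 2 * m))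
    * qShifted q q (J + m) / (qShifted q q m * qShifted q Z (J + m + 1))
    * (-Z) ^ m * q ^ m.choose 2

/-- The `j`-th summand with the numerator `∏_{r, s} (a x_r / x_s)_{j_r}`. -/
noncomputable def vanTerm {n : ℕ} (q a : ℂ) (x : Fin n → ℂ) (j : Fin n → ℕ) : ℂ :=
  vanKernel q x j * ∏ r, ∏ s, qShifted q (a * (x r / x s)) (j r)

theorem qShifted_self_ne {q : ℂ} (hq1 : ‖q‖ < 1) (m : ℕ) : qShifted q q m ≠ 0 := by
  refine prod_ne_zero_iff.2 fun i _ h => ?_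
  have h1 : q ^ (i + 1) = 1 := by rw [pow_succ']; linear_combination -h
  have h2 := congrArg norm h1
  rw [norm_pow, norm_one] at h2
  exact (pow_lt_one₀ (norm_nonneg q) hq1 (Nat.succ_ne_zero i)).ne h2

theorem choose_two_add (m p : ℕ) : (m + p).choose 2 = m.choose 2 + p.choose 2 + m * p := by
  induction p with
  | zero => simp
  | succ p ih =>
    rw [← add_assoc, Nat.choose_succ_succ' (m + p) 1, Nat.choose_succ_succ' p 1, ih]
    simp only [Nat.choose_one_right]
    ring

/-- Expand `chuPoly`, interchange, and sum over `k` first by `sum_levelTerm`. The diagonal value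
`vanKernel_mul_backFactor` absorbs the remaining sign and power of `q`. -/
theorem sum_chuPoly_level {n : ℕ} {q : ℂ} (hq1 : ‖q‖ < 1) (a c Z : ℂ) {x : Fin n → ℂ}
    (h : AnGeneric q x) (hc : ∀ i, ∀ m : ℕ, qShifted q (c * x i) m ≠ 0) (K : ℕ) :
    ∑ k ∈ piAntidiag univ K, vanTerm q a x k
        * ((1 - a ^ n * Z * q ^ (2 * K)) * qShifted q q K / qShifted q Z (K + 1))
        * ((-Z) ^ K * q ^ K.choose 2) * chuPoly q c x k (a ^ n * Z * q ^ K)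
      = ∑ m ∈ range (K + 1), ∑ j ∈ piAntidiag univ m,
          vanTerm q a x j / (∏ i, qShifted q (c * x i) (j i))
            * (Z ^ m * rogersTerm q (a ^ n * q ^ m) Z m (K - m)) := by
  set g : ℂ := ((1 - a ^ n * Z * q ^ (2 * K)) * qShifted q q K / qShifted q Z (K + 1))
        * ((-Z) ^ K * q ^ K.choose 2) with hg
  have h1 : ∀ k ∈ piAntidiag (univ : Finset (Fin n)) K, vanTerm q a x k
        * ((1 - a ^ n * Z * q ^ (2 * K)) * qShifted q q K / qShifted q Z (K + 1))
        * ((-Z) ^ K * q ^ K.choose 2) * chuPoly q c x k (a ^ n * Z * q ^ K)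
      = ∑ m ∈ range (K + 1), ∑ j ∈ piAntidiag univ m,
          (g * q ^ m * qShifted q (a ^ n * Z * q ^ K) m
            * (vanKernel q x j / ∏ i, qShifted q (c * x i) (j i))) * levelTerm q a x j k := by
    intro k hk
    have hk' : ∑ s, k s = K := by simpa using hk
    rw [← sum_chuSum h hc _ k K hk'.le, mul_sum]
    refine sum_congr rfl fun m _ => ?_
    rw [chuSum, mul_sum, sum_mul, mul_sum]
    refine sum_congr rfl fun j _ => ?_
    simp only [vanTerm, levelTerm, hg]
    ring
  rw [sum_congr rfl h1, sum_comm]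
  refine sum_congr rfl fun m hm => ?_
  rw [sum_comm]
  refine sum_congr rfl fun j hj => ?_
  have hj' : ∑ s, j s = m := by simpa using hj
  obtain ⟨p, rfl⟩ : ∃ p, K = m + p := ⟨K - m, by have := mem_range.1 hm; omega⟩
  rw [← mul_sum, Nat.add_sub_cancel_left]
  have hL := sum_levelTerm a h j p
  have hD := vanKernel_mul_backFactor h j
  rw [hj'] at hL hD
  have hqp := qShifted_self_ne hq1 p
  have hq := h.q_ne
  have hq2 := pow_ne_zero (m * p) hq
  rw [← eq_div_iff (mul_ne_zero hq2 hqp)] at hL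
  rw [hL]
  have hA1 : a ^ n * q ^ m * Z * q ^ p = a ^ n * Z * q ^ (m + p) := by rw [pow_add]; ring
  have hA2 : a ^ n * q ^ m * Z * q ^ (m + 2 * p) = a ^ n * Z * q ^ (2 * (m + p)) := by
    rw [show 2 * (m + p) = m + (m + 2 * p) by ring, pow_add _ m (m + 2 * p)]; ring
  -- Splits `K = m + p` so that `(-1)^m q^((m+1).choose 2)` cancels against the diagonal value and
  -- `q^(m p)` against the level sum.
  have hg' : g * q ^ m = (1 - a ^ n * Z * q ^ (2 * (m + p))) * qShifted q q (m + p)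
      / qShifted q Z (m + p + 1) * Z ^ m * (-Z) ^ p * q ^ p.choose 2
      * ((-1) ^ m * q ^ (m + 1).choose 2) * q ^ (m * p) := by
    rw [hg, choose_two_add m p, choose_two_add m 1, Nat.choose_eq_zero_of_lt (by norm_num : 1 < 2)]
    simp only [pow_add, add_zero, mul_one]
    rw [neg_pow Z m]
    ring
  simp only [rogersTerm, hA1, hA2, vanTerm, levelTerm]
  have hfin : ∀ (N C T Q : ℂ), g * q ^ m * Q * (vanKernel q x j / C)
        * (vanKernel q x j * backFactor q x j j * N * T / (q ^ (m * p) * qShifted q q p))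
      = vanKernel q x j * N / C * (Z ^ m * (T * Q * (1 - a ^ n * Z * q ^ (2 * (m + p)))
        * qShifted q q (m + p) / (qShifted q q p * qShifted q Z (m + p + 1)) * (-Z) ^ p
        * q ^ p.choose 2)) := by
    intro N C T Q
    rw [hg']
    have e : ∀ u v : ℂ, u / (q ^ (m * p) * v) = u / v * (q ^ (m * p))⁻¹ := by
      intro u v; rw [mul_comm, div_mul_eq_div_div, div_eq_mul_inv (u / v)]
    rw [e]
    have e2 : q ^ (m * p) * (q ^ (m * p))⁻¹ = 1 := mul_inv_cancel₀ hq2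
    simp only [div_eq_mul_inv, mul_inv]
    linear_combination (vanKernel q x j * N * C⁻¹ * Z ^ m * T * Q
      * (1 - a ^ n * Z * q ^ (2 * (m + p))) * qShifted q q (m + p) * (qShifted q q p)⁻¹
      * (qShifted q Z (m + p + 1))⁻¹ * (-Z) ^ p * q ^ p.choose 2) * 
        ((q ^ (m * p) * (q ^ (m * p))⁻¹) * hD + e2)
  exact hfin _ _ _ _

/-! ### Translation of the stated terms into normal form. -/

/-- The weight supplies one factor `q^(k s)` for each `r < s`, which clears the negative exponents
in `AnFactor`. -/
theorem AnFactor_mul_pow {n : ℕ} {q : ℂ} {x : Fin n → ℂ} (h : AnGeneric q x) (k : Fin n → ℕ) :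
    AnFactor q x k * q ^ AnWeight k = vanRatio q x k := by
  have hw : q ^ AnWeight k = ∏ r : Fin n, ∏ s ∈ Ioi r, q ^ k s := by
    have : ∏ r : Fin n, ∏ s ∈ Ioi r, q ^ k s = ∏ s : Fin n, ∏ r ∈ Iio s, q ^ k s :=
      prod_comm' (by simp)
    rw [this, AnWeight, ← prod_pow_eq_pow_sum]
    refine prod_congr rfl fun s _ => ?_
    rw [prod_const, Fin.card_Iio, ← pow_mul, mul_comm]
  rw [hw, AnFactor, vanRatio, ← prod_mul_distrib]
  refine prod_congr rfl fun r _ => ?_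
  rw [← prod_mul_distrib]
  refine prod_congr rfl fun s hs => ?_
  have h1 := h.x_ne s
  have h2 := pow_ne_zero (k s) h.q_ne
  have h3 : x s - x r ≠ 0 := sub_ne_zero.2 fun he => (mem_Ioi.1 hs).ne (h.inj he).symm
  have e : 1 - x r / x s = (x s - x r) / x s := by field_simp
  rw [e, zpow_sub₀ h.q_ne, zpow_natCast, zpow_natCast]
  simp only [latticeShift]
  field_simp

theorem AnFactor_mul_AnRatio_mul_pow {n : ℕ} {q : ℂ} (a : ℂ) {x : Fin n → ℂ}
    (h : AnGeneric q x) (k : Fin n → ℕ) :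
    AnFactor q x k * AnRatio q a x k * q ^ AnWeight k = vanTerm q a x k := by
  rw [mul_right_comm, AnFactor_mul_pow h, AnRatio, vanTerm, vanKernel]
  simp only [prod_div_distrib]
  ring

theorem secondLhsTerm_eq {n : ℕ} {q : ℂ} (a b z : ℂ) {x : Fin n → ℂ} (h : AnGeneric q x)
    (j : Fin n → ℕ) :
    secondLhsTerm q a b z x j = vanTerm q a x j / (∏ i, qShifted q (b * x i) (j i))
      * (qShifted q q (∑ s, j s) * (z / a ^ (n - 1)) ^ ∑ s, j s) := by
  rw [← AnFactor_mul_AnRatio_mul_pow a h, secondLhsTerm, multiLen]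
  ring

theorem firstLhsTerm_eq {n : ℕ} {q : ℂ} (a b z : ℂ) {x : Fin n → ℂ} (h : AnGeneric q x)
    (j : Fin n → ℕ) :
    firstLhsTerm q a b z x j = vanTerm q a x j
      * (qShifted q q (∑ s, j s) / qShifted q b (∑ s, j s) * (z / a ^ (n - 1)) ^ ∑ s, j s) := by
  rw [← AnFactor_mul_AnRatio_mul_pow a h, firstLhsTerm, multiLen]
  ring

/-- Read the product backwards: the factor with index `k - 1 - m` times `β q^m` is `-(y q^K - β
q^m)`. -/
theorem qShifted_mul_pow_eq (q y β : ℂ) (hβ : β ≠ 0) {k K : ℕ} (hk : k ≤ K) :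
    qShifted q (y * q ^ (1 + K - k) / β) k * (β ^ k * q ^ k.choose 2)
      = (-1) ^ k * ∏ m ∈ range k, (y * q ^ K - β * q ^ m) := by
  rw [Nat.choose_two_right, ← sum_range_id, ← prod_pow_eq_pow_sum, qShifted,
    ← prod_range_reflect]
  have e1 : ∀ t : ℂ, t ^ k = ∏ _m ∈ range k, t := fun t => by simp
  rw [e1 β, e1 (-1), ← prod_mul_distrib, ← prod_mul_distrib, ← prod_mul_distrib]
  refine prod_congr rfl fun m hm => ?_
  have hm' := mem_range.1 hm
  have e : q ^ K = q ^ (1 + K - k) * q ^ (k - 1 - m) * q ^ m := by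
    rw [← pow_add, ← pow_add]; congr 1; omega
  rw [e]
  field_simp
  ring

theorem prod_qShifted_eq_chuPoly {n : ℕ} {q : ℂ} (y b : ℂ) {x : Fin n → ℂ} (hx : ∀ i, x i ≠ 0)
    (hb : b ≠ 0) (k : Fin n → ℕ) :
    (∏ i, qShifted q (y * q ^ (1 + (∑ s, k s) - k i) / (b * x i)) (k i)
        / qShifted q (b * x i) (k i))
      * (b ^ (∑ s, k s) * q ^ (∑ i, (k i).choose 2) * ∏ i, x i ^ k i)
      = (-1) ^ (∑ s, k s) * chuPoly q b x k (y * q ^ ∑ s, k s) := by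
  rw [chuPoly]
  have e1 : ∀ t : ℂ, t ^ (∑ s, k s) = ∏ s, t ^ k s := fun t => (prod_pow_eq_pow_sum _ _ _).symm
  rw [e1 b, e1 (-1), ← prod_pow_eq_pow_sum, ← prod_mul_distrib,
    ← prod_mul_distrib, ← prod_mul_distrib, ← prod_mul_distrib]
  refine prod_congr rfl fun i _ => ?_
  have := qShifted_mul_pow_eq q y (b * x i) (mul_ne_zero hb (hx i))
    (single_le_sum (fun s _ => Nat.zero_le (k s)) (mem_univ i))
  rw [mul_pow] at this
  rw [← mul_div_assoc, ← this]
  ring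

theorem secondRhsTerm_eq {n : ℕ} {q a b z Z : ℂ} {x : Fin n → ℂ} (h : AnGeneric q x)
    (hb : b ≠ 0) (hZ : Z = z / a ^ (n - 1)) (haz : a * z = a ^ n * Z) (k : Fin n → ℕ) :
    secondRhsTerm q a b z x k = vanTerm q a x k
        * ((1 - a ^ n * Z * q ^ (2 * ∑ s, k s)) * qShifted q q (∑ s, k s)
          / qShifted q Z ((∑ s, k s) + 1))
        * ((-Z) ^ (∑ s, k s) * q ^ (∑ s, k s).choose 2)
        * chuPoly q b x k (a ^ n * Z * q ^ ∑ s, k s) := by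
  have h1 := prod_qShifted_eq_chuPoly (q := q) (a ^ n * Z) b h.x_ne hb k
  have h2 : b * z / a ^ (n - 1) = b * Z := by rw [hZ]; ring
  rw [← AnFactor_mul_AnRatio_mul_pow a h, secondRhsTerm, multiLen, haz, h2, ← hZ, neg_pow Z,
    pow_add, pow_add, mul_pow]
  linear_combination (AnFactor q x k * AnRatio q a x k * q ^ AnWeight k
    * ((1 - a ^ n * Z * q ^ (2 * ∑ s, k s)) * qShifted q q (∑ s, k s)
          / qShifted q Z ((∑ s, k s) + 1)) * Z ^ (∑ s, k s) * q ^ (∑ s, k s).choose 2) * h1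

/-- The one-dimensional form of the factors depending on `|k|` only. -/
theorem firstRhsTerm_eq {n : ℕ} {q a b z Z : ℂ} {x : Fin n → ℂ} (h : AnGeneric q x)
    (hb : b ≠ 0) (hZ : Z = z / a ^ (n - 1)) (haz : a * z = a ^ n * Z) (k : Fin n → ℕ) :
    firstRhsTerm q a b z x k = vanTerm q a x k
        * ((1 - a ^ n * Z * q ^ (2 * ∑ s, k s)) * qShifted q q (∑ s, k s)
          / qShifted q Z ((∑ s, k s) + 1))
        * ((-Z) ^ (∑ s, k s) * q ^ (∑ s, k s).choose 2)
        * chuPoly q b (fun _ : Fin 1 => 1) (fun _ => ∑ s, k s) (a ^ n * Z * q ^ ∑ s, k s) := by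
  have h1 := prod_qShifted_eq_chuPoly (q := q) (x := fun _ : Fin 1 => 1) (a ^ n * Z) b
    (fun _ => one_ne_zero) hb (fun _ => ∑ s, k s)
  have h2 : b * z / a ^ (n - 1) = b * Z := by rw [hZ]; ring
  simp only [univ_unique, sum_const, card_singleton, one_smul, prod_singleton, mul_one, one_pow,
    Nat.add_sub_cancel, pow_one] at h1
  rw [← AnFactor_mul_AnRatio_mul_pow a h, firstRhsTerm, multiLen, haz, h2, ← hZ, neg_pow Z,
    pow_add, two_mul (Nat.choose _ _), pow_add, mul_pow]
  linear_combination (AnFactor q x k * AnRatio q a x k * q ^ AnWeight k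
    * ((1 - a ^ n * Z * q ^ (2 * ∑ s, k s)) * qShifted q q (∑ s, k s)
          / qShifted q Z ((∑ s, k s) + 1)) * Z ^ (∑ s, k s) * q ^ (∑ s, k s).choose 2) * h1

/-- The case `j = 0` of the level sum. The answer sees neither `x` nor `n` except through `a^n`,
which reduces the first identity to dimension one. -/
theorem sum_vanTerm {n : ℕ} {q : ℂ} (hq1 : ‖q‖ < 1) (a : ℂ) {x : Fin n → ℂ} (h : AnGeneric q x)
    (K : ℕ) : ∑ k ∈ piAntidiag univ K, vanTerm q a x k = qShifted q (a ^ n) K / qShifted q q K := by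
  have := sum_levelTerm a h 0 K
  rw [eq_div_iff (qShifted_self_ne hq1 K)]
  simpa [levelTerm, backFactor, qShifted_zero, vanKernel_zero h, vanTerm] using this

theorem AnGeneric.const_one {q : ℂ} (hq0 : q ≠ 0) (hq1 : ‖q‖ < 1) :
    AnGeneric q (fun _ : Fin 1 => 1) where
  q_ne := hq0
  x_ne _ := one_ne_zero
  inj := Function.injective_of_subsingleton _
  pow_ne r s m := by
    intro h1
    have h2 := congrArg norm h1
    rw [one_mul, norm_pow, norm_one] at h2
    exact (pow_lt_one₀ (norm_nonneg q) hq1 (Nat.succ_ne_zero m)).ne h2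

theorem piAntidiag_univ_fin_one (K : ℕ) :
    piAntidiag (univ : Finset (Fin 1)) K = {fun _ => K} := by
  ext k
  simp only [mem_piAntidiag, univ_unique, sum_singleton, mem_singleton]
  constructor
  · rintro ⟨h, _⟩
    funext i
    rw [← h, Subsingleton.elim i default]
  · rintro rfl
    exact ⟨rfl, fun i _ => Subsingleton.elim _ _⟩

theorem AnGeneric.of_ne {n : ℕ} {q : ℂ} {x : Fin n → ℂ} (hq : q ≠ 0) (hx : ∀ r, x r ≠ 0)
    (hxx : ∀ r s, r < s → 1 - x r / x s ≠ 0)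
    (hqx : ∀ r s, ∀ m : ℕ, qShifted q (q * (x r / x s)) m ≠ 0) : AnGeneric q x where
  q_ne := hq
  x_ne := hx
  inj := by
    have aux : ∀ r s, r < s → x r ≠ x s := fun r s hrs he =>
      hxx r s hrs (by rw [he, div_self (hx s), sub_self])
    intro r s he
    rcases lt_trichotomy r s with hlt | heq | hgt
    · exact absurd he (aux r s hlt)
    · exact heq
    · exact absurd he.symm (aux s r hgt)
  pow_ne r s m he := by
    have h1 := hqx r s (m + 1)
    rw [qShifted_succ] at h1
    refine right_ne_zero_of_mul h1 ?_
    have := hx s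
    field_simp
    rw [← he, pow_succ]
    ring

/-! ### Bounds for `q`-shifted factorials and the one-dimensional series. -/

theorem sum_range_pow_le_inv {r : ℝ} (h0 : 0 ≤ r) (h1 : r < 1) (m : ℕ) :
    ∑ i ∈ range m, r ^ i ≤ (1 - r)⁻¹ := by
  rw [← tsum_geometric_of_lt_one h0 h1]
  exact (summable_geometric_of_lt_one h0 h1).sum_le_tsum _ fun _ _ => by positivity

theorem norm_qShifted_le {q u : ℂ} (hq1 : ‖q‖ < 1) {R : ℝ} (hu : ‖u‖ ≤ R) (m : ℕ) :
    ‖qShifted q u m‖ ≤ Real.exp (R / (1 - ‖q‖)) := by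
  have hR : 0 ≤ R := (norm_nonneg u).trans hu
  calc ‖qShifted q u m‖ = ∏ i ∈ range m, ‖1 - u * q ^ i‖ := by rw [qShifted, norm_prod]
    _ ≤ ∏ i ∈ range m, (1 + R * ‖q‖ ^ i) := by
        refine prod_le_prod (fun _ _ => norm_nonneg _) fun i _ => ?_
        refine (norm_sub_le _ _).trans ?_
        rw [norm_one, norm_mul, norm_pow]
        gcongr
    _ ≤ Real.exp (∑ i ∈ range m, R * ‖q‖ ^ i) :=
        Real.prod_one_add_le_exp_sum _ fun i => by positivity
    _ ≤ Real.exp (R / (1 - ‖q‖)) := by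
        gcongr
        rw [← mul_sum, div_eq_mul_inv]
        gcongr
        exact sum_range_pow_le_inv (norm_nonneg q) hq1 m

/-- The infinite product converges to a nonzero limit, so the reciprocals of the partial products
converge and are bounded. -/
theorem exists_norm_inv_qShifted_le {q u : ℂ} (hq1 : ‖q‖ < 1) (hu : ∀ m, qShifted q u m ≠ 0) :
    ∃ C, ∀ m, ‖(qShifted q u m)⁻¹‖ ≤ C := by
  have hsum : Summable fun i : ℕ => ‖-(u * q ^ i)‖ := by
    simp only [norm_neg, norm_mul, norm_pow]
    exact (summable_geometric_of_lt_one (norm_nonneg q) hq1).mul_left _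
  have hne : ∀ i : ℕ, 1 + -(u * q ^ i) ≠ 0 := by
    intro i
    have := hu (i + 1)
    rw [qShifted_succ] at this
    rw [← sub_eq_add_neg]
    exact right_ne_zero_of_mul this
  have hlim := (multipliable_one_add_of_summable hsum).hasProd.tendsto_prod_nat
  have h0 := tprod_one_add_ne_zero_of_summable hne hsum
  have hb := (hlim.inv₀ h0).norm.bddAbove_range
  obtain ⟨C, hC⟩ := hb
  refine ⟨C, fun m => ?_⟩
  have := hC (Set.mem_range_self m)
  simpa [qShifted, sub_eq_add_neg] using this

theorem qShifted_ne_zero_of_norm_lt_one {q Z : ℂ} (hq1 : ‖q‖ < 1) (hZ : ‖Z‖ < 1) (m : ℕ) :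
    qShifted q Z m ≠ 0 := by
  refine prod_ne_zero_iff.2 fun i _ h => ?_
  have h1 : Z * q ^ i = 1 := by linear_combination -h
  have h2 := congrArg norm h1
  rw [norm_mul, norm_pow, norm_one] at h2
  have h3 : ‖Z‖ * ‖q‖ ^ i ≤ ‖Z‖ :=
    mul_le_of_le_one_right (norm_nonneg _) (pow_le_one₀ (norm_nonneg _) hq1.le)
  linarith

/-- The part of `rogersTerm` without its very-well-poised factor. -/
noncomputable def rogersCore (q B Z : ℂ) (J m : ℕ) : ℂ :=
  qShifted q B m * qShifted q (B * Z * q ^ m) J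
    * qShifted q q (J + m) / (qShifted q q m * qShifted q Z (J + m + 1))
    * (-Z) ^ m * q ^ m.choose 2

theorem rogersTerm_eq (q B Z : ℂ) (J m : ℕ) :
    rogersTerm q B Z J m = rogersCore q B Z J m * (1 - B * Z * q ^ (J + 2 * m)) := by
  rw [rogersTerm, rogersCore]; ring

/-- Uniformity in `B` and `J` matters: the application has `B = a^n q^m` and `J = m`, with `m`
summed over. -/
theorem exists_norm_rogersCore_le {q Z : ℂ} (hq1 : ‖q‖ < 1) (hZ : ‖Z‖ < 1) {R : ℝ} (hR : 0 ≤ R) :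
    ∃ C, 0 ≤ C ∧ ∀ B : ℂ, ‖B‖ ≤ R → ∀ J m, ‖rogersCore q B Z J m‖ ≤ C * ‖Z‖ ^ m := by
  obtain ⟨C1, hC1⟩ := exists_norm_inv_qShifted_le hq1 (qShifted_self_ne hq1)
  obtain ⟨C2, hC2⟩ := exists_norm_inv_qShifted_le hq1 (qShifted_ne_zero_of_norm_lt_one hq1 hZ)
  have h1 : 0 ≤ C1 := (norm_nonneg _).trans (hC1 0)
  have h2 : 0 ≤ C2 := (norm_nonneg _).trans (hC2 0)
  set E := Real.exp (R / (1 - ‖q‖))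
  set E' := Real.exp (1 / (1 - ‖q‖))
  refine ⟨E * E * E' * (C1 * C2), by positivity, fun B hB J m => ?_⟩
  have e : rogersCore q B Z J m = qShifted q B m * qShifted q (B * Z * q ^ m) J
    * qShifted q q (J + m) * ((qShifted q q m)⁻¹ * (qShifted q Z (J + m + 1))⁻¹)
    * (-Z) ^ m * q ^ m.choose 2 := by rw [rogersCore, div_eq_mul_inv, mul_inv]
  rw [e]
  simp only [norm_mul, norm_pow, norm_neg]
  have hB' : ‖B * Z * q ^ m‖ ≤ R := by
    rw [norm_mul, norm_mul, norm_pow]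
    calc ‖B‖ * ‖Z‖ * ‖q‖ ^ m ≤ R * 1 * 1 := by
          gcongr
          exact pow_le_one₀ (norm_nonneg _) hq1.le
      _ = R := by ring
  have hB1 : ‖qShifted q B m‖ ≤ E := norm_qShifted_le hq1 hB m
  have hB2 : ‖qShifted q (B * Z * q ^ m) J‖ ≤ E := norm_qShifted_le hq1 hB' J
  have hB3 : ‖qShifted q q (J + m)‖ ≤ E' := norm_qShifted_le hq1 hq1.le _
  have hB4 : ‖q‖ ^ m.choose 2 ≤ 1 := pow_le_one₀ (norm_nonneg _) hq1.le
  have hB5 := hC1 m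
  have hB6 := hC2 (J + m + 1)
  rw [← mul_one (E * E * E' * (C1 * C2) * ‖Z‖ ^ m)]
  gcongr

/-- A telescoping certificate in `m`. The telescoped quantity vanishes at `m = 0` and tends to `0`,
so the sums inherit the recurrence of `(q)_J`. -/
theorem rogersTerm_succ_sub {q B Z : ℂ} (hq0 : q ≠ 0) (hq1 : ‖q‖ < 1) (hZ : ‖Z‖ < 1) (J m : ℕ) :
    rogersTerm q B Z (J + 1) m - (1 - q ^ (J + 1)) * rogersTerm q B Z J m
      = q ^ J * (q - B * Z * q ^ m) * (1 - q ^ m) * rogersCore q B Z J m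
        - q ^ J * (q - B * Z * q ^ (m + 1)) * (1 - q ^ (m + 1)) * rogersCore q B Z J (m + 1) := by
  have hd : 1 - Z * q ^ (J + m + 1) ≠ 0 := by
    have := qShifted_ne_zero_of_norm_lt_one hq1 hZ (J + m + 2)
    rw [qShifted_succ] at this
    exact right_ne_zero_of_mul this
  have hz1 := qShifted_ne_zero_of_norm_lt_one hq1 hZ (J + m + 1)
  have hm1 : 1 - q * q ^ m ≠ 0 := by
    have := qShifted_self_ne hq1 (m + 1)
    rw [qShifted_succ] at this
    exact right_ne_zero_of_mul this
  have hm0 := qShifted_self_ne hq1 m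
  have h1 : rogersCore q B Z (J + 1) m = rogersCore q B Z J m
      * ((1 - B * Z * q ^ m * q ^ J) * (1 - q * q ^ (J + m)) / (1 - Z * q ^ (J + m + 1))) := by
    simp only [rogersCore]
    rw [show J + 1 + m = J + m + 1 by ring, qShifted_succ q (B * Z * q ^ m) J,
      qShifted_succ q q (J + m), qShifted_succ q Z (J + m + 1)]
    field_simp
  -- The factor `1 - B Z q^m` may vanish, so it is carried along rather than divided out.
  have h2 : (1 - B * Z * q ^ m) * (1 - q ^ (m + 1)) * rogersCore q B Z J (m + 1)
      = rogersCore q B Z J m * ((1 - B * q ^ m) * (1 - B * Z * q ^ m * q ^ J)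
          * (1 - q * q ^ (J + m)) * (-Z) * q ^ m / (1 - Z * q ^ (J + m + 1))) := by
    have hs := qShifted_shift q (B * Z * q ^ m) J
    have hc : (m + 1).choose 2 = m + m.choose 2 := by
      rw [Nat.choose_succ_succ' m 1, Nat.choose_one_right]
    simp only [rogersCore]
    rw [show J + (m + 1) = J + m + 1 by ring, qShifted_succ q B m, qShifted_succ q q m,
      qShifted_succ q q (J + m), qShifted_succ q Z (J + m + 1), hc, pow_add q m (m.choose 2),
      pow_succ q m, ← mul_assoc (B * Z), mul_comm (q ^ m) q, pow_succ (-Z)]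
    generalize qShifted q (B * Z * q ^ m * q) J = S' at *
    generalize qShifted q (B * Z * q ^ m) J = S at *
    generalize qShifted q Z (J + m + 1) = V at *
    generalize qShifted q q m = W at *
    generalize 1 - Z * q ^ (J + m + 1) = D at *
    generalize 1 - q * q ^ m = D' at *
    have e : D' * D'⁻¹ = 1 := mul_inv_cancel₀ hm1
    simp only [div_eq_mul_inv, mul_inv]
    linear_combination (qShifted q B m * (1 - B * q ^ m) * qShifted q q (J + m)
      * (1 - q * q ^ (J + m)) * W⁻¹ * V⁻¹ * D⁻¹ * (-Z) ^ m * (-Z) * q ^ m * q ^ m.choose 2)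
      * (S * (1 - B * Z * q ^ m * q ^ J) * e - D' * D'⁻¹ * hs)
  rw [rogersTerm_eq, rogersTerm_eq, h1]
  have h3 : q ^ J * (q - B * Z * q ^ (m + 1)) * (1 - q ^ (m + 1)) * rogersCore q B Z J (m + 1)
      = q ^ J * q * ((1 - B * Z * q ^ m) * (1 - q ^ (m + 1)) * rogersCore q B Z J (m + 1)) := by
    ring
  rw [h3, h2]
  field_simp
  ring

theorem rogersTerm_zero {q B Z : ℂ} (hq1 : ‖q‖ < 1) (hZ : ‖Z‖ < 1) (m : ℕ) :
    rogersTerm q B Z 0 m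
      = qShifted q B m / qShifted q Z m * (-Z) ^ m * q ^ m.choose 2
        - qShifted q B (m + 1) / qShifted q Z (m + 1) * (-Z) ^ (m + 1) * q ^ (m + 1).choose 2 := by
  have hz0 := qShifted_ne_zero_of_norm_lt_one hq1 hZ m
  have hz1 := qShifted_ne_zero_of_norm_lt_one hq1 hZ (m + 1)
  have hm0 := qShifted_self_ne hq1 m
  have hc : (m + 1).choose 2 = m + m.choose 2 := by
    rw [Nat.choose_succ_succ' m 1, Nat.choose_one_right]
  rw [qShifted_succ] at hz1
  have hz2 := right_ne_zero_of_mul hz1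
  simp only [rogersTerm, zero_add, qShifted_zero, qShifted_succ, hc]
  field_simp
  ring

theorem tendsto_sum_rogersTerm {q B Z : ℂ} (hq0 : q ≠ 0) (hq1 : ‖q‖ < 1) (hZ : ‖Z‖ < 1) (J : ℕ) :
    Tendsto (fun M => ∑ m ∈ range M, rogersTerm q B Z J m) atTop (𝓝 (qShifted q q J)) := by
  induction J with
  | zero =>
    obtain ⟨C, hC⟩ := exists_norm_inv_qShifted_le hq1 (qShifted_ne_zero_of_norm_lt_one hq1 hZ)
    have hC0 : 0 ≤ C := (norm_nonneg _).trans (hC 0)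
    have hlim : Tendsto (fun m => qShifted q B m / qShifted q Z m * (-Z) ^ m * q ^ m.choose 2)
        atTop (𝓝 0) := by
      refine squeeze_zero_norm (a := fun m => Real.exp (‖B‖ / (1 - ‖q‖)) * C * ‖Z‖ ^ m) ?_ ?_
      · intro m
        have h1 := norm_qShifted_le hq1 (le_refl ‖B‖) m
        have h2 := hC m
        have h3 : ‖q‖ ^ m.choose 2 ≤ 1 := pow_le_one₀ (norm_nonneg _) hq1.le
        rw [div_eq_mul_inv]
        simp only [norm_mul, norm_pow, norm_neg]
        rw [← mul_one (_ * C * ‖Z‖ ^ m)]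
        gcongr
      · simpa using (tendsto_pow_atTop_nhds_zero_of_lt_one (norm_nonneg Z) hZ).const_mul
          (Real.exp (‖B‖ / (1 - ‖q‖)) * C)
    simp only [rogersTerm_zero hq1 hZ, sum_range_sub']
    simpa [qShifted_zero] using hlim.const_sub 1
  | succ J ih =>
    obtain ⟨C, hC0, hC⟩ := exists_norm_rogersCore_le hq1 hZ (norm_nonneg B)
    have hlim : Tendsto (fun m => q ^ J * (q - B * Z * q ^ m) * (1 - q ^ m)
        * rogersCore q B Z J m) atTop (𝓝 0) := by
      have hq := tendsto_pow_atTop_nhds_zero_of_norm_lt_one hq1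
      have h1 : Tendsto (fun m => rogersCore q B Z J m) atTop (𝓝 0) := by
        refine squeeze_zero_norm (hC B le_rfl J) ?_
        simpa using (tendsto_pow_atTop_nhds_zero_of_lt_one (norm_nonneg Z) hZ).const_mul C
      have h2 := (((hq.const_mul (B * Z)).const_sub q).const_mul (q ^ J)).mul (hq.const_sub 1)
      simpa using h2.mul h1
    have hsum : ∀ M, ∑ m ∈ range M, rogersTerm q B Z (J + 1) m
        = (1 - q ^ (J + 1)) * ∑ m ∈ range M, rogersTerm q B Z J m
          - q ^ J * (q - B * Z * q ^ M) * (1 - q ^ M) * rogersCore q B Z J M := by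
      intro M
      have h := sum_range_sub' (fun m => q ^ J * (q - B * Z * q ^ m) * (1 - q ^ m)
        * rogersCore q B Z J m) M
      rw [← sum_congr rfl fun m _ => rogersTerm_succ_sub (B := B) hq0 hq1 hZ J m,
        sum_sub_distrib, ← mul_sum] at h
      simp only [pow_zero, sub_self, mul_zero, zero_mul, zero_sub] at h
      linear_combination h
    simp only [hsum]
    have := (ih.const_mul (1 - q ^ (J + 1))).sub hlim
    rw [sub_zero] at this
    convert this using 2
    rw [qShifted_succ, pow_succ']
    ring

theorem exists_norm_sum_rogersTerm_le {q Z : ℂ} (hq1 : ‖q‖ < 1) (hZ : ‖Z‖ < 1) {R : ℝ}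
    (hR : 0 ≤ R) :
    ∃ C, 0 ≤ C ∧ ∀ B : ℂ, ‖B‖ ≤ R → ∀ J M, ‖∑ m ∈ range M, rogersTerm q B Z J m‖ ≤ C := by
  obtain ⟨C, hC0, hC⟩ := exists_norm_rogersCore_le hq1 hZ hR
  refine ⟨C * (1 + R) * (1 - ‖Z‖)⁻¹, ?_, fun B hB J M => ?_⟩
  · have : 0 < 1 - ‖Z‖ := by linarith
    positivity
  · calc ‖∑ m ∈ range M, rogersTerm q B Z J m‖
        ≤ ∑ m ∈ range M, C * (1 + R) * ‖Z‖ ^ m := by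
          refine norm_sum_le_of_le _ fun m _ => ?_
          rw [rogersTerm_eq, norm_mul, mul_right_comm C]
          have h1 : ‖1 - B * Z * q ^ (J + 2 * m)‖ ≤ 1 + R := by
            refine (norm_sub_le _ _).trans ?_
            rw [norm_one, norm_mul, norm_mul, norm_pow]
            gcongr
            calc ‖B‖ * ‖Z‖ * ‖q‖ ^ (J + 2 * m) ≤ R * 1 * 1 := by
                  gcongr
                  exact pow_le_one₀ (norm_nonneg _) hq1.le
              _ = R := by ring
          have h2 := hC B hB J m
          gcongr
      _ ≤ C * (1 + R) * (1 - ‖Z‖)⁻¹ := by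
          rw [← mul_sum]
          gcongr
          exact sum_range_pow_le_inv (norm_nonneg Z) hZ M

/-! ### Summability over multi-indices. -/

theorem summable_pow_sum {n : ℕ} {r : ℝ} (h0 : 0 ≤ r) (h1 : r < 1) :
    Summable fun j : Fin n → ℕ => r ^ ∑ s, j s := by
  refine summable_of_sum_le (c := ((1 - r)⁻¹) ^ n) (fun j => by positivity) fun u => ?_
  obtain ⟨N, hN⟩ : ∃ N, ∀ j ∈ u, ∀ s, j s < N := by
    refine ⟨u.sup (fun j => ∑ s, j s) + 1, fun j hj s => Nat.lt_succ_of_le ?_⟩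
    exact (single_le_sum (fun s _ => Nat.zero_le (j s)) (mem_univ s)).trans
      (le_sup (f := fun j : Fin n → ℕ => ∑ s, j s) hj)
  calc ∑ j ∈ u, r ^ ∑ s, j s ≤ ∑ j ∈ Fintype.piFinset fun _ : Fin n => range N, r ^ ∑ s, j s := by
        refine sum_le_sum_of_subset_of_nonneg (fun j hj => ?_) fun _ _ _ => by positivity
        exact Fintype.mem_piFinset.2 fun s => mem_range.2 (hN j hj s)
    _ = ∏ _s : Fin n, ∑ m ∈ range N, r ^ m := by
        rw [prod_univ_sum]
        exact sum_congr rfl fun j _ => (prod_pow_eq_pow_sum _ _ _).symm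
    _ ≤ ∏ _s : Fin n, (1 - r)⁻¹ :=
        prod_le_prod (fun _ _ => sum_nonneg fun _ _ => by positivity)
          fun _ _ => sum_range_pow_le_inv h0 h1 N
    _ = ((1 - r)⁻¹) ^ n := by simp

theorem hasSum_level {n : ℕ} {f : (Fin n → ℕ) → ℂ} (hf : Summable f) :
    HasSum (fun m => ∑ j ∈ piAntidiag univ m, f j) (∑' j, f j) := by
  have h := hf.hasSum.tsum_fiberwise (fun j => ∑ s, j s)
  have e : ∀ m, (fun j : Fin n → ℕ => ∑ s, j s) ⁻¹' {m}
      = ((piAntidiag univ m : Finset (Fin n → ℕ)) : Set (Fin n → ℕ)) := by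
    intro m; ext j; simp
  have e' : (fun m => ∑ j ∈ piAntidiag univ m, f j)
      = fun m => ∑' j : (fun j : Fin n → ℕ => ∑ s, j s) ⁻¹' {m}, f j := by
    funext m
    rw [e]
    exact (Finset.tsum_subtype _ f).symm
  rw [e']
  exact h

theorem exists_norm_prod_le {n : ℕ} (φ : Fin n → ℕ → ℂ) (h : ∀ i, ∃ C, ∀ m, ‖φ i m‖ ≤ C) :
    ∃ C, ∀ k : Fin n → ℕ, ‖∏ i, φ i (k i)‖ ≤ C := by
  choose C hC using h
  refine ⟨∏ i, C i, fun k => ?_⟩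
  rw [norm_prod]
  exact prod_le_prod (fun _ _ => norm_nonneg _) fun i _ => hC i _

theorem exists_norm_vanRatio_le {n : ℕ} {q : ℂ} (hq1 : ‖q‖ < 1) (x : Fin n → ℂ) :
    ∃ C, ∀ k, ‖vanRatio q x k‖ ≤ C := by
  refine ⟨∏ r, ∏ s ∈ Ioi r, (‖x s‖ + ‖x r‖) / ‖x s - x r‖, fun k => ?_⟩
  simp only [vanRatio, norm_prod, norm_div]
  refine prod_le_prod (fun _ _ => by positivity) fun r _ => prod_le_prod (fun _ _ => by positivity)
    fun s _ => ?_
  gcongr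
  have : ∀ i, ‖latticeShift q x k i‖ ≤ ‖x i‖ := by
    intro i
    rw [latticeShift, norm_mul, norm_pow]
    exact mul_le_of_le_one_right (norm_nonneg _) (pow_le_one₀ (norm_nonneg _) hq1.le)
  exact (norm_sub_le _ _).trans (add_le_add (this s) (this r))

theorem exists_norm_vanTerm_le {n : ℕ} {q : ℂ} (hq1 : ‖q‖ < 1) (a : ℂ) {x : Fin n → ℂ}
    (h : AnGeneric q x) : ∃ C, ∀ k, ‖vanTerm q a x k‖ ≤ C := by
  obtain ⟨C1, h1⟩ := exists_norm_vanRatio_le hq1 x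
  obtain ⟨C2, h2⟩ := exists_norm_prod_le
    (fun r m => ∏ s, (qShifted q (a * (x r / x s)) m * (qShifted q (q * (x r / x s)) m)⁻¹)) <| by
    intro r
    obtain ⟨C, hC⟩ := exists_norm_prod_le (n := n)
      (fun s m => qShifted q (a * (x r / x s)) m * (qShifted q (q * (x r / x s)) m)⁻¹) <| by
      intro s
      obtain ⟨C, hC⟩ := exists_norm_inv_qShifted_le hq1 (h.qShifted_ne r s)
      refine ⟨Real.exp (‖a * (x r / x s)‖ / (1 - ‖q‖)) * C, fun m => ?_⟩
      rw [norm_mul]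
      exact mul_le_mul (norm_qShifted_le hq1 le_rfl m) (hC m) (norm_nonneg _) (by positivity)
    exact ⟨C, fun m => hC fun _ => m⟩
  refine ⟨C1 * C2, fun k => ?_⟩
  have e : vanTerm q a x k = vanRatio q x k * ∏ r, ∏ s,
      (qShifted q (a * (x r / x s)) (k r) * (qShifted q (q * (x r / x s)) (k r))⁻¹) := by
    simp only [vanTerm, vanKernel, prod_mul_distrib, prod_inv_distrib]
    ring
  rw [e, norm_mul]
  exact mul_le_mul (h1 k) (h2 k) (norm_nonneg _) ((norm_nonneg _).trans (h1 k))

/-- Consecutive terms have ratio `R ρ^K`, eventually at most `1`. -/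
theorem exists_pow_mul_pow_choose_le {ρ : ℝ} (h0 : 0 ≤ ρ) (h1 : ρ < 1) {R : ℝ} (hR : 0 ≤ R) :
    ∃ C, 0 ≤ C ∧ ∀ K : ℕ, R ^ K * ρ ^ K.choose 2 ≤ C := by
  have hlim : Tendsto (fun K : ℕ => R * ρ ^ K) atTop (𝓝 0) := by
    simpa using (tendsto_pow_atTop_nhds_zero_of_lt_one h0 h1).const_mul R
  obtain ⟨N, hN⟩ := eventually_atTop.1 (hlim.eventually (ge_mem_nhds one_pos))
  set f : ℕ → ℝ := fun K => R ^ K * ρ ^ K.choose 2 with hf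
  have hf0 : ∀ K, 0 ≤ f K := fun K => by positivity
  have hle : ∀ K ∈ range (N + 1), f K ≤ ∑ i ∈ range (N + 1), f i := fun K hK =>
    single_le_sum (fun i _ => hf0 i) hK
  refine ⟨∑ i ∈ range (N + 1), f i, sum_nonneg fun i _ => hf0 i, fun K => ?_⟩
  rcases le_total K N with h | h
  · exact hle K (by simp; omega)
  · refine le_trans ?_ (hle N (by simp))
    induction K, h using Nat.le_induction with
    | base => exact le_rfl
    | succ K hK ih =>
      refine le_trans ?_ ih
      have e : R ^ (K + 1) * ρ ^ (K + 1).choose 2 = f K * (R * ρ ^ K) := by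
        rw [Nat.choose_succ_succ' K 1, Nat.choose_one_right, pow_add, pow_succ]
        simp only [hf]; ring
      rw [e]
      exact mul_le_of_le_one_right (hf0 K) (hN K hK)

theorem exists_norm_chuPoly_le {n : ℕ} {q : ℂ} (hq1 : ‖q‖ < 1) (c : ℂ) {x : Fin n → ℂ}
    (hc : ∀ i, ∀ m : ℕ, qShifted q (c * x i) m ≠ 0) {Y : ℝ} (hY : 0 ≤ Y) :
    ∃ C R : ℝ, 0 ≤ R ∧ ∀ k y, ‖y‖ ≤ Y → ‖chuPoly q c x k y‖ ≤ C * R ^ ∑ s, k s := by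
  obtain ⟨C, hC⟩ := exists_norm_prod_le (fun i m => (qShifted q (c * x i) m)⁻¹)
    fun i => exists_norm_inv_qShifted_le hq1 (hc i)
  refine ⟨C, Y + ∑ i, ‖c * x i‖, by positivity, fun k y hy => ?_⟩
  have e : chuPoly q c x k y = (∏ i, (qShifted q (c * x i) (k i))⁻¹)
      * ∏ i, ∏ m ∈ range (k i), (y - c * x i * q ^ m) := by
    simp only [chuPoly, div_eq_mul_inv, prod_mul_distrib]
    ring
  rw [e, norm_mul]
  refine mul_le_mul (hC k) ?_ (norm_nonneg _) ((norm_nonneg _).trans (hC k))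
  rw [norm_prod, ← prod_pow_eq_pow_sum]
  refine prod_le_prod (fun _ _ => norm_nonneg _) fun i _ => ?_
  rw [norm_prod, ← card_range (k i), ← prod_const]
  rw [card_range]
  refine prod_le_prod (fun _ _ => norm_nonneg _) fun m _ => ?_
  refine (norm_sub_le _ _).trans (add_le_add hy ?_)
  rw [norm_mul, norm_pow]
  exact (mul_le_of_le_one_right (norm_nonneg _) (pow_le_one₀ (norm_nonneg _) hq1.le)).trans
    (single_le_sum (f := fun i => ‖c * x i‖) (fun _ _ => norm_nonneg _) (mem_univ i))

theorem summable_of_norm_le_mul_pow {n : ℕ} {f : (Fin n → ℕ) → ℂ} {C r : ℝ} (h0 : 0 ≤ r)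
    (h1 : r < 1) (hf : ∀ k, ‖f k‖ ≤ C * r ^ ∑ s, k s) : Summable f :=
  Summable.of_norm_bounded ((summable_pow_sum h0 h1).mul_left C) hf

/-- `chuPoly` grows at most geometrically in `|k|`, which `q^(|k|.choose 2)` overwhelms. The map `κ`
allows both `k` itself and the one-entry index `|k|`, as the two identities require. -/
theorem summable_rhs {n n' : ℕ} {q : ℂ} (hq1 : ‖q‖ < 1) {Z : ℂ} (hZ : ‖Z‖ < 1) (a c A : ℂ)
    {x : Fin n → ℂ} (h : AnGeneric q x) {x' : Fin n' → ℂ}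
    (hc : ∀ i, ∀ m : ℕ, qShifted q (c * x' i) m ≠ 0) (κ : (Fin n → ℕ) → Fin n' → ℕ)
    (hκ : ∀ k, ∑ s, κ k s = ∑ s, k s) :
    Summable fun k : Fin n → ℕ => vanTerm q a x k
        * ((1 - A * Z * q ^ (2 * ∑ s, k s)) * qShifted q q (∑ s, k s)
          / qShifted q Z ((∑ s, k s) + 1))
        * ((-Z) ^ (∑ s, k s) * q ^ (∑ s, k s).choose 2)
        * chuPoly q c x' (κ k) (A * Z * q ^ ∑ s, k s) := by
  obtain ⟨C1, h1⟩ := exists_norm_vanTerm_le hq1 a h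
  obtain ⟨C2, h2⟩ := exists_norm_inv_qShifted_le hq1 (qShifted_ne_zero_of_norm_lt_one hq1 hZ)
  obtain ⟨C3, R, hR, h3⟩ := exists_norm_chuPoly_le hq1 c hc (norm_nonneg (A * Z))
  obtain ⟨C4, h40, h4⟩ := exists_pow_mul_pow_choose_le (norm_nonneg q) hq1
    (R := 2 * (‖Z‖ * R)) (by positivity)
  have hAZ : ∀ K : ℕ, ‖A * Z * q ^ K‖ ≤ ‖A * Z‖ := fun K => by
    rw [norm_mul, norm_pow]
    exact mul_le_of_le_one_right (norm_nonneg _) (pow_le_one₀ (norm_nonneg _) hq1.le)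
  have hC1 : 0 ≤ C1 := (norm_nonneg _).trans (h1 0)
  have hC2 : 0 ≤ C2 := (norm_nonneg _).trans (h2 0)
  have hC3 : 0 ≤ C3 := by
    have := (norm_nonneg _).trans (h3 0 0 (by rw [norm_zero]; exact norm_nonneg _))
    simpa using this
  set E := Real.exp (1 / (1 - ‖q‖))
  -- The ratio `1 / 2` is paid for by the factor `2` built into the bound `h4`.
  refine summable_of_norm_le_mul_pow (C := C1 * ((1 + ‖A * Z‖) * E * C2) * C3 * C4) (r := 1 / 2)
    (by norm_num) (by norm_num) fun k => ?_
  set K := ∑ s, k s with hK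
  have b1 : ‖1 - A * Z * q ^ (2 * K)‖ ≤ 1 + ‖A * Z‖ := by
    refine (norm_sub_le _ _).trans ?_
    rw [norm_one]
    exact add_le_add le_rfl (hAZ _)
  have b2 : ‖qShifted q q K‖ ≤ E := norm_qShifted_le hq1 hq1.le K
  have b3 := h2 (K + 1)
  have b4 : ‖chuPoly q c x' (κ k) (A * Z * q ^ K)‖ ≤ C3 * R ^ K := by
    have := h3 (κ k) _ (hAZ K)
    rwa [hκ, ← hK] at this
  have b5 := h1 k
  rw [div_eq_mul_inv]
  simp only [norm_mul, norm_pow, norm_neg] at b1 ⊢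
  calc _ ≤ C1 * ((1 + ‖A‖ * ‖Z‖) * E * C2) * (‖Z‖ ^ K * ‖q‖ ^ K.choose 2) * (C3 * R ^ K) := by
        gcongr
    _ = C1 * ((1 + ‖A‖ * ‖Z‖) * E * C2) * C3
          * ((2 * (‖Z‖ * R)) ^ K * ‖q‖ ^ K.choose 2) * (1 / 2) ^ K := by
        rw [mul_pow, mul_pow, one_div, inv_pow]
        field_simp
    _ ≤ _ := by
        gcongr
        exact h4 K

theorem exists_norm_vanTerm_div_le {n : ℕ} {q : ℂ} (hq1 : ‖q‖ < 1) (a c : ℂ)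
    {x : Fin n → ℂ} (h : AnGeneric q x) (hc : ∀ i, ∀ m : ℕ, qShifted q (c * x i) m ≠ 0) :
    ∃ C, ∀ j, ‖vanTerm q a x j / ∏ i, qShifted q (c * x i) (j i)‖ ≤ C := by
  obtain ⟨C1, h1⟩ := exists_norm_vanTerm_le hq1 a h
  obtain ⟨C2, h2⟩ := exists_norm_prod_le (fun i m => (qShifted q (c * x i) m)⁻¹)
    fun i => exists_norm_inv_qShifted_le hq1 (hc i)
  refine ⟨C1 * C2, fun j => ?_⟩
  rw [div_eq_mul_inv, ← prod_inv_distrib, norm_mul]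
  exact mul_le_mul (h1 j) (h2 j) (norm_nonneg _) ((norm_nonneg _).trans (h1 j))

theorem summable_mul_level {n : ℕ} {Z : ℂ} (hZ : ‖Z‖ < 1) {w : (Fin n → ℕ) → ℂ}
    (hw : ∃ C, ∀ j, ‖w j‖ ≤ C) {t : ℕ → ℂ} (ht : ∃ C, ∀ m, ‖t m‖ ≤ C) :
    Summable fun j : Fin n → ℕ => w j * (t (∑ s, j s) * Z ^ ∑ s, j s) := by
  obtain ⟨C, hC⟩ := hw
  obtain ⟨D, hD⟩ := ht
  refine summable_of_norm_le_mul_pow (C := C * D) (norm_nonneg Z) hZ fun j => ?_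
  rw [norm_mul, norm_mul, norm_pow, mul_assoc]
  have h1 : 0 ≤ C := (norm_nonneg _).trans (hC 0)
  have h2 : 0 ≤ D := (norm_nonneg _).trans (hD 0)
  exact mul_le_mul (hC j) (mul_le_mul_of_nonneg_right (hD _) (by positivity)) (by positivity) h1

theorem exists_norm_qShifted_self_le {q : ℂ} (hq1 : ‖q‖ < 1) : ∃ C, ∀ m, ‖qShifted q q m‖ ≤ C :=
  ⟨_, fun m => norm_qShifted_le hq1 le_rfl m⟩

/-! ### The normalized identity and the two stated ones. -/

/-- The `A_n` Rogers–Fine identity in normalized form. -/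
theorem tsum_vanTerm_eq {n : ℕ} {q : ℂ} (hq0 : q ≠ 0) (hq1 : ‖q‖ < 1) (a c : ℂ) {Z : ℂ}
    (hZ : ‖Z‖ < 1) {x : Fin n → ℂ} (h : AnGeneric q x)
    (hc : ∀ i, ∀ m : ℕ, qShifted q (c * x i) m ≠ 0) :
    ∑' j : Fin n → ℕ, vanTerm q a x j / (∏ i, qShifted q (c * x i) (j i))
        * (qShifted q q (∑ s, j s) * Z ^ ∑ s, j s)
      = ∑' k : Fin n → ℕ, vanTerm q a x k
        * ((1 - a ^ n * Z * q ^ (2 * ∑ s, k s)) * qShifted q q (∑ s, k s)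
          / qShifted q Z ((∑ s, k s) + 1))
        * ((-Z) ^ (∑ s, k s) * q ^ (∑ s, k s).choose 2)
        * chuPoly q c x k (a ^ n * Z * q ^ ∑ s, k s) := by
  set w : (Fin n → ℕ) → ℂ := fun j => vanTerm q a x j / ∏ i, qShifted q (c * x i) (j i) with hw
  have hwb := exists_norm_vanTerm_div_le hq1 a c h hc
  have hL := hasSum_level (summable_mul_level hZ hwb (exists_norm_qShifted_self_le hq1))
  have hR := hasSum_level (summable_rhs hq1 hZ a c (a ^ n) h hc id fun _ => rfl)
  simp only [id] at hR
  have hN : Summable fun m => ∑ j ∈ piAntidiag (univ : Finset (Fin n)) m, ‖w j‖ * ‖Z‖ ^ m := by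
    have h1 : Summable fun j : Fin n → ℕ => (‖w j‖ : ℂ) * (1 * (‖Z‖ : ℂ) ^ ∑ s, j s) := by
      refine summable_mul_level (Z := (‖Z‖ : ℂ)) (t := fun _ => 1) (by simpa using hZ) ?_
        ⟨1, by simp⟩
      simpa only [Complex.norm_real, norm_norm] using hwb
    have h2 := (hasSum_level h1).summable
    rw [← Complex.summable_ofReal]
    refine h2.congr fun m => ?_
    push_cast
    refine sum_congr rfl fun j hj => ?_
    have hj' : ∑ s, j s = m := by simpa using hj
    rw [hj', one_mul]
  obtain ⟨C, hC0, hC⟩ := exists_norm_sum_rogersTerm_le hq1 hZ (norm_nonneg (a ^ n))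
  -- The triangular partial sum `m + p < M`, grouped by `m`. Truncated subtraction makes the inner
  -- sum empty for `m ≥ M`, so each `F M` has finite support.
  let F : ℕ → ℕ → ℂ := fun M m => ∑ j ∈ piAntidiag univ m, w j
    * (Z ^ m * ∑ p ∈ range (M - m), rogersTerm q (a ^ n * q ^ m) Z m p)
  have hdom : Tendsto (fun M => ∑' m, F M m) atTop
      (𝓝 (∑' m, ∑ j ∈ piAntidiag univ m, w j * (Z ^ m * qShifted q q m))) := by
    refine tendsto_tsum_of_dominated_convergence (hN.mul_right C) (fun m => ?_)
      (Eventually.of_forall fun M m => ?_)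
    · refine tendsto_finsetSum _ fun j _ => ((Tendsto.const_mul _ ?_).const_mul _)
      exact (tendsto_sum_rogersTerm hq0 hq1 hZ m).comp (tendsto_sub_atTop_nat m)
    · rw [sum_mul]
      refine norm_sum_le_of_le _ fun j _ => ?_
      rw [norm_mul, norm_mul, norm_pow, mul_assoc]
      have hB : ‖a ^ n * q ^ m‖ ≤ ‖a ^ n‖ := by
        rw [norm_mul, norm_pow q]
        exact mul_le_of_le_one_right (norm_nonneg _) (pow_le_one₀ (norm_nonneg _) hq1.le)
      have := hC _ hB m (M - m)
      gcongr
  have hpart : ∀ M, ∑' m, F M m = ∑ K ∈ range M, ∑ k ∈ piAntidiag univ K, (vanTerm q a x k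
        * ((1 - a ^ n * Z * q ^ (2 * ∑ s, k s)) * qShifted q q (∑ s, k s)
          / qShifted q Z ((∑ s, k s) + 1))
        * ((-Z) ^ (∑ s, k s) * q ^ (∑ s, k s).choose 2)
        * chuPoly q c x k (a ^ n * Z * q ^ ∑ s, k s)) := by
    intro M
    rw [tsum_eq_sum (s := range M)]
    · have h1 : ∀ K, ∑ k ∈ piAntidiag univ K, (vanTerm q a x k
          * ((1 - a ^ n * Z * q ^ (2 * ∑ s, k s)) * qShifted q q (∑ s, k s)
            / qShifted q Z ((∑ s, k s) + 1))
          * ((-Z) ^ (∑ s, k s) * q ^ (∑ s, k s).choose 2)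
          * chuPoly q c x k (a ^ n * Z * q ^ ∑ s, k s))
          = ∑ m ∈ range (K + 1), ∑ j ∈ piAntidiag univ m,
            w j * (Z ^ m * rogersTerm q (a ^ n * q ^ m) Z m (K - m)) := by
        intro K
        rw [← sum_chuPoly_level hq1 a c Z h hc K]
        refine sum_congr rfl fun k hk => ?_
        have hk' : ∑ s, k s = K := by simpa using hk
        rw [hk']
      rw [sum_congr rfl fun K _ => h1 K,
        sum_range_diag_flip M fun m p => ∑ j ∈ piAntidiag univ m,
            w j * (Z ^ m * rogersTerm q (a ^ n * q ^ m) Z m p)]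
      refine sum_congr rfl fun m _ => ?_
      rw [sum_comm]
      refine sum_congr rfl fun j _ => ?_
      rw [mul_sum, mul_sum]
    · intro m hm
      have : M - m = 0 := by have := mt mem_range.2 hm; omega
      simp [F, this]
  simp only [hpart] at hdom
  rw [← tendsto_nhds_unique hdom hR.tendsto_sum_nat, ← hL.tsum_eq]
  refine tsum_congr fun m => sum_congr rfl fun j hj => ?_
  have hj' : ∑ s, j s = m := by simpa using hj
  rw [hj', mul_comm (Z ^ m)]

theorem mainTheorem9 (n : ℕ) (hn : 1 ≤ n) (q a b z : ℂ) (x : Fin n → ℂ)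
    (hq0 : 0 < ‖q‖) (hq1 : ‖q‖ < 1)
    (hz : ‖z / a ^ (n - 1)‖ < 1)
    -- non-vanishing of the denominators that occur in both identities
    (ha : a ^ (n - 1) ≠ 0) (hb : b ≠ 0) (hx : ∀ r, x r ≠ 0)
    (hxx : ∀ r s, r < s → 1 - x r / x s ≠ 0)
    (hqx : ∀ r s, ∀ m : ℕ, qShifted q (q * (x r / x s)) m ≠ 0) :
    -- first identity
    ((∀ m : ℕ, qShifted q b m ≠ 0) →
      Summable (fun j : Fin n → ℕ => firstLhsTerm q a b z x j) ∧
      Summable (fun k : Fin n → ℕ => firstRhsTerm q a b z x k) ∧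
      ∑' j : Fin n → ℕ, firstLhsTerm q a b z x j
        = ∑' k : Fin n → ℕ, firstRhsTerm q a b z x k) ∧
    -- second identity
    ((∀ i, ∀ m : ℕ, qShifted q (b * x i) m ≠ 0) →
      Summable (fun j : Fin n → ℕ => secondLhsTerm q a b z x j) ∧
      Summable (fun k : Fin n → ℕ => secondRhsTerm q a b z x k) ∧
      ∑' j : Fin n → ℕ, secondLhsTerm q a b z x j
        = ∑' k : Fin n → ℕ, secondRhsTerm q a b z x k) := by
  have hq : q ≠ 0 := norm_pos_iff.1 hq0
  have h : AnGeneric q x := AnGeneric.of_ne hq hx hxx hqx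
  -- Uses `n ≥ 1`; when `n = 1` the value `a = 0` is still allowed.
  have haz : a * z = a ^ n * (z / a ^ (n - 1)) := by
    obtain ⟨m, rfl⟩ : ∃ m, n = m + 1 := ⟨n - 1, by omega⟩
    rw [Nat.add_sub_cancel] at ha ⊢
    rw [pow_succ']
    field_simp
  refine ⟨fun hbm => ?_, fun hbx => ?_⟩
  · have h1 : AnGeneric q (fun _ : Fin 1 => 1) := AnGeneric.const_one hq hq1
    have hb1 : ∀ _i : Fin 1, ∀ m : ℕ, qShifted q (b * 1) m ≠ 0 := fun _ m => by
      rw [mul_one]; exact hbm m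
    simp only [firstLhsTerm_eq a b z h, firstRhsTerm_eq h hb rfl haz]
    set Z := z / a ^ (n - 1)
    have hbd : ∃ C, ∀ m, ‖qShifted q q m / qShifted q b m‖ ≤ C := by
      obtain ⟨C1, hC1⟩ := exists_norm_qShifted_self_le hq1
      obtain ⟨C2, hC2⟩ := exists_norm_inv_qShifted_le hq1 hbm
      refine ⟨C1 * C2, fun m => ?_⟩
      rw [div_eq_mul_inv, norm_mul]
      exact mul_le_mul (hC1 m) (hC2 m) (norm_nonneg _) ((norm_nonneg _).trans (hC1 m))
    have sL := summable_mul_level hz (exists_norm_vanTerm_le hq1 a h) hbd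
    have sR := summable_rhs hq1 hz a b (a ^ n) h hb1 (fun k _ => ∑ s, k s) fun k => by simp
    refine ⟨sL, sR, ?_⟩
    have key := tsum_vanTerm_eq hq hq1 (a ^ n) b hz h1 hb1
    have sL1 := hasSum_level (summable_mul_level hz
      (exists_norm_vanTerm_div_le hq1 (a ^ n) b h1 hb1) (exists_norm_qShifted_self_le hq1))
    have sR1 := hasSum_level (summable_rhs hq1 hz (a ^ n) b (a ^ n) h1 hb1 id fun _ => rfl)
    -- A single one-dimensional term with parameter `a^n` equals a whole level of the
    -- `n`-dimensional sum, so both sides can be compared level by level.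
    have hv : ∀ K, vanTerm q (a ^ n) (fun _ : Fin 1 => 1) (fun _ => K)
        = ∑ k ∈ piAntidiag univ K, vanTerm q a x k := by
      intro K
      have := sum_vanTerm hq1 (a ^ n) h1 K
      rw [piAntidiag_univ_fin_one, sum_singleton, pow_one] at this
      rw [this, sum_vanTerm hq1 a h K]
    simp only [pow_one] at key
    simp only [id] at sR1
    rw [← (hasSum_level sL).tsum_eq, ← (hasSum_level sR).tsum_eq]
    refine Eq.trans ?_ (Eq.trans (sL1.tsum_eq.trans (key.trans sR1.tsum_eq.symm)) ?_)
    · refine tsum_congr fun K => ?_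
      rw [piAntidiag_univ_fin_one, sum_singleton, hv, sum_div, sum_mul]
      refine sum_congr rfl fun k hk => ?_
      have hk' : ∑ s, k s = K := by simpa using hk
      simp only [hk', univ_unique, sum_const, prod_const, card_singleton, one_smul, pow_one, mul_one]
      ring
    · refine tsum_congr fun K => ?_
      rw [piAntidiag_univ_fin_one, sum_singleton, hv, sum_mul, sum_mul, sum_mul]
      refine sum_congr rfl fun k hk => ?_
      have hk' : ∑ s, k s = K := by simpa using hk
      simp only [hk', univ_unique, sum_const, card_singleton, one_smul]
  · simp only [secondLhsTerm_eq a b z h, secondRhsTerm_eq h hb rfl haz]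
    exact ⟨summable_mul_level hz (exists_norm_vanTerm_div_le hq1 a b h hbx)
        (exists_norm_qShifted_self_le hq1),
      summable_rhs hq1 hz a b (a ^ n) h hbx id fun _ => rfl,
      tsum_vanTerm_eq hq hq1 a b hz h hbx⟩
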